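/- Let $0<b<1/\sqrt2$ and $\mu>0$. Let $M=\mathbb R\times(\mathbb R/2\mathbb Z)$ be the cylinder with points $u=(t,x)$ and measure $du=dt\,dx$ (the circle having length $2$). For $\tau\in\mathbb C$ with $\operatorname{Re}\tau\ge0$ and $x\in\mathbb R/2\mathbb Z$ put $$g(\tau,x)=-\tfrac{\pi\tau}{2}-\tfrac12\log\bigl(1-e^{-\pi\tau+\pi i x}\bigr)-\tfrac12\log\bigl(1-e^{-\pi\tau-\pi i x}\bigr)$$ with the principal logarithm, wherever both arguments of the logarithm are nonzero. Let $k\ge1$ and let $n_1,\dots,n_k\in\mathbb Z$ satisfy $|n_j|<\frac1{\sqrt2\,b}$. Put $\alpha_j=bn_j$ and $w=-\sum_{j=1}^k n_j$. For $u_j=(t_j,x_j)\in M$, let $v_j=(it_j,x_j)$ and let $\gamma:\mathbb R\to\mathbb C$ be the contour that comes in horizontally from $it_1-\infty$ to $it_1$, then moves straight to $it_2$, then to $it_3$, and so on to $it_k$, and then leaves horizontally to $it_k+\infty$; the points $v_1,\dots,v_k$ are regarded as marked visits of the contour, in this order. For two points $p,p'$ on $\gamma\times(\mathbb R/2\mathbb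 Z)$ with given contour parameters, let $\mathcal T(p-p')$ be the one of $p,p'$ with the larger contour parameter minus the one with the smaller (so $\mathcal T(v_j-v_{j'})=v_{j'}-v_j$ for $j<j'$). If $w\ge0$, define $$C^{\mathrm L}_{b\boldsymbol n}(u_1,\dots,u_k)=\frac{(-\mu)^w}{w!}\exp\Bigl(-4\sum_{j<j'}\alpha_j\alpha_{j'}\,g(\mathcal T(v_j-v_{j'}))\Bigr)\int\exp\Bigl(-4b\sum_{j=1}^k\sum_{l=1}^w\alpha_j\,g(\mathcal T(v_j-U_l))-4b^2\sum_{l<l'}g(\mathcal T(U_l-U_{l'}))\Bigr)\prod_{l=1}^w\gamma'(s_l)\,ds_l\,dy_l,$$ where $U_l=(\gamma(s_l),y_l)$ and the integral is over $(s_l,y_l)\in\mathbb R\times(\mathbb R/2\mathbb Z)$, $1\le l\le w$ (it is $1$ if $w=0$). If $w<0$, put $C^{\mathrm L}_{b\boldsymbol n}\equiv0$. On the null set of those $(u_1,\dots,u_k)$ for which $(t_j-t_{j'})+(x_j-x_{j'})\in2\mathbb Z$ or $(t_j-t_{j'})-(x_j-x_{j'})\in2\mathbb Z$ for some $j<j'$,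 the correlator $C^{\mathrm L}_{b\boldsymbol n}$ may be assigned arbitrary values. **Theorem.** If $w\ge0$, the integral defining $C^{\mathrm L}_{b\boldsymbol n}(u_1,\dots,u_k)$ is absolutely convergent for almost every $(u_1,\dots,u_k)\in M^k$. For any $f_1,\dots,f_k\in C_c^\infty(M,\mathbb C)$, the integral $$\int_{M^k}\prod_{j=1}^k f_j(u_j)\,C^{\mathrm L}_{b\boldsymbol n}(u_1,\dots,u_k)\,du_1\cdots du_k$$ is absolutely convergent, and its value does not depend on the values assigned to $C^{\mathrm L}_{b\boldsymbol n}$ on the exceptional set. In particular, the smeared vacuum expectation is finite. -/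

import Mathlib

open MeasureTheory
open scoped ContDiff

noncomputable section

namespace TimelikeLiouville

instance factTwoPos : Fact ((0 : ℝ) < 2) := ⟨two_pos⟩

/-- The infinite cylinder `M`: time in `ℝ`, space in `ℝ / 2ℤ`, i.e. `[-1, 1]` with its end points
identified. Its volume is `dt dx`, the circle having total length `2`. -/
abbrev Cylinder : Type := ℝ × AddCircle (2 : ℝ)

/-- `f ∈ C_c^∞(M, ℂ)`: the lift of `f` to the plane is smooth, and `f` has compact support. -/
structure IsTestFunction (f : Cylinder → ℂ) : Prop where
  smooth : ContDiff ℝ ∞ (fun p : ℝ × ℝ => f (p.1, (p.2 : AddCircle (2 : ℝ))))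
  compact : HasCompactSupport f

/-- The character `x ↦ e^{π i x}` of the circle `ℝ / 2ℤ`. -/
def circleChar (x : AddCircle (2 : ℝ)) : ℂ := (AddCircle.toCircle x : ℂ)

theorem circleChar_coe (x : ℝ) :
    circleChar (x : AddCircle (2 : ℝ)) = Complex.exp (Real.pi * Complex.I * x) := by
  unfold circleChar
  rw [AddCircle.toCircle_apply_mk, Circle.coe_exp]
  congr 1
  push_cast
  ring

/-- The Green's function `g(τ, x)` with complex time `τ`, `Re τ ≥ 0`:
`-πτ/2 - (1/2) log(1 - e^{-πτ + πix}) - (1/2) log(1 - e^{-πτ - πix})`, principal logarithm. -/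
def green (p : ℂ × AddCircle (2 : ℝ)) : ℂ :=
  -(Real.pi * p.1 / 2)
    - 1 / 2 * Complex.log (1 - Complex.exp (-(Real.pi * p.1)) * circleChar p.2)
    - 1 / 2 * Complex.log (1 - Complex.exp (-(Real.pi * p.1)) * circleChar (-p.2))

theorem green_coe (τ : ℂ) (x : ℝ) :
    green (τ, (x : AddCircle (2 : ℝ))) =
      -(Real.pi * τ / 2)
        - 1 / 2 * Complex.log (1 - Complex.exp (-Real.pi * τ + Real.pi * Complex.I * x))
        - 1 / 2 * Complex.log (1 - Complex.exp (-Real.pi * τ - Real.pi * Complex.I * x)) := by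
  have h : (-(x : AddCircle (2 : ℝ))) = ((-x : ℝ) : AddCircle (2 : ℝ)) := rfl
  simp only [green, h, circleChar_coe, ← Complex.exp_add]
  congr 5 <;> push_cast <;> ring_nf

/-- The contour `γ` for the real times `t 0, …, t m`. It runs horizontally from `i t₀ - ∞` to
`i t₀` (for `s ≤ 0`), straight from `i t_j` to `i t_{j+1}` (for `j ≤ s ≤ j + 1`), and horizontally
from `i t_m` to `i t_m + ∞` (for `s ≥ m`). The marked visit of `i t_j` has parameter `s = j`. -/
def contour {m : ℕ} (t : Fin (m + 1) → ℝ) (s : ℝ) : ℂ :=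
  ((min s 0 + max (s - m) 0 : ℝ) : ℂ) +
    Complex.I * ((t 0 + ∑ j : Fin m,
      max 0 (min 1 (s - (j : ℕ))) * (t j.succ - t j.castSucc) : ℝ) : ℂ)

/-- The time-ordered difference `𝒯(p - p')` of points with contour parameters `s` and `s'`:
the later point minus the earlier one. -/
def timeOrdered (s s' : ℝ) (p p' : ℂ × AddCircle (2 : ℝ)) : ℂ × AddCircle (2 : ℝ) :=
  if s' ≤ s then p - p' else p' - p

/-- The external insertion `v_j = (i t_j, x_j)`. -/
def external {m : ℕ} (u : Fin (m + 1) → Cylinder) (j : Fin (m + 1)) : ℂ × AddCircle (2 : ℝ) :=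
  (Complex.I * ((u j).1 : ℂ), (u j).2)

/-- The point `(γ(s), x)` of the tube `M_γ` with contour parameter `s` and space coordinate `x`. -/
def tubePoint {m : ℕ} (u : Fin (m + 1) → Cylinder) (z : ℝ × AddCircle (2 : ℝ)) :
    ℂ × AddCircle (2 : ℝ) :=
  (contour (fun j => (u j).1) z.1, z.2)

/-- The factor `exp(-4 ∑_{j<j'} α_j α_{j'} g(𝒯(v_j - v_{j'})))`. -/
def freeFactor {m : ℕ} (α : Fin (m + 1) → ℂ) (u : Fin (m + 1) → Cylinder) : ℂ :=
  Complex.exp (-4 * ∑ j : Fin (m + 1), ∑ j' ∈ Finset.Ioi j,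
    α j * α j' * green (timeOrdered (j : ℕ) (j' : ℕ) (external u j) (external u j')))

/-- The integrand of the contour integral over `M_γ^w`, in the variables `(s_l, x_l)` and with the
Jacobian `γ'(s_1) ⋯ γ'(s_w)` included. -/
def screeningIntegrand {m : ℕ} (b : ℝ) (w : ℕ) (α : Fin (m + 1) → ℂ)
    (u : Fin (m + 1) → Cylinder) (z : Fin w → ℝ × AddCircle (2 : ℝ)) : ℂ :=
  Complex.exp
      (-4 * b * (∑ j : Fin (m + 1), ∑ l : Fin w,
          α j * green (timeOrdered (j : ℕ) (z l).1 (external u j) (tubePoint u (z l))))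
        - 4 * b ^ 2 * (∑ l : Fin w, ∑ l' ∈ Finset.Ioi l,
          green (timeOrdered (z l).1 (z l').1 (tubePoint u (z l)) (tubePoint u (z l')))))
    * ∏ l : Fin w, deriv (contour (fun j => (u j).1)) (z l).1

/-- The Lorentzian correlator `C^L_{α_0, …, α_m}` with `w` screening insertions. -/
def lorentzCorrelator {m : ℕ} (b μ : ℝ) (w : ℕ) (α : Fin (m + 1) → ℂ)
    (u : Fin (m + 1) → Cylinder) : ℂ :=
  (-(μ : ℂ)) ^ w / (w.factorial : ℂ) * freeFactor α u * ∫ z, screeningIntegrand b w α u z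

/-- The charges `α_j = b n_j`. -/
def charge {m : ℕ} (b : ℝ) (n : Fin (m + 1) → ℤ) (j : Fin (m + 1)) : ℂ := (b : ℂ) * (n j : ℂ)

/-- The Lorentzian correlator `C^L_{b n}` with integer charges; it vanishes identically if the
screening number `w(n) = -∑ n_j` is negative. -/
def integerCorrelator {m : ℕ} (b μ : ℝ) (n : Fin (m + 1) → ℤ) (u : Fin (m + 1) → Cylinder) : ℂ :=
  if 0 ≤ -∑ j, n j then lorentzCorrelator b μ (-∑ j, n j).toNat (charge b n) u else 0

/-- No difference `(t, x)` of two of the points has `t + x ∈ 2ℤ` or `t - x ∈ 2ℤ`. -/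
def NonLightCone {m : ℕ} (u : Fin (m + 1) → Cylinder) : Prop :=
  ∀ j j' : Fin (m + 1), j < j' →
    (((u j).1 - (u j').1 : ℝ) : AddCircle (2 : ℝ)) + ((u j).2 - (u j').2) ≠ 0 ∧
    (((u j).1 - (u j').1 : ℝ) : AddCircle (2 : ℝ)) - ((u j).2 - (u j').2) ≠ 0

/-- The smeared vacuum expectation `⟨𝒪_{f_0,n_0} ⋯ 𝒪_{f_m,n_m}⟩`. -/
def smearedExpectation {m : ℕ} (b μ : ℝ) (n : Fin (m + 1) → ℤ)
    (f : Fin (m + 1) → Cylinder → ℂ) : ℂ :=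
  ∫ u : Fin (m + 1) → Cylinder, (∏ j, f j (u j)) * integerCorrelator b μ n u

end TimelikeLiouville

end

noncomputable section

namespace TimelikeLiouville

/-! ### Positive definiteness and the electrostatic inequality -/

section Electrostatics

variable {P : Type*} [Fintype P]

/-! All estimates are made in absolute value. Along the contour the real part of time never
decreases, so time-ordered differences have nonnegative real part, and -2 Re g of two points splits
into π|ΔRe τ| plus one logarithm for each light-cone coordinate (`green_timeOrdered_re`). The
modulus of the full integrand is therefore the Boltzmann weight of a gas of real charges, b n_j at
the external points and b at the screening points, of total charge zero
(`norm_freeFactor_mul_norm_screeningIntegrand`).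

Neutrality turns the linear part of the energy into exponential decay along the horizontal ends
(`sum_charges_mul_abs_sub_le`). The logarithmic parts obey an Onsager-type bound
(`sum_log_chiral_le`): since the regularized kernel is positive definite, the interaction is
controlled by the self-energies of charges smeared at scales ε_p below their distances to opposite
charges. This replaces the many-body singularity by a product of factors ε_p^(-a_p²) for each
light-cone coordinate.

The ε_p can be chosen as functions of the points rotated to real time Re τ + Im τ, because rotation
enlarges a chiral distance by a factor of at most 5 (`chord_add_le`). Under this rotation |γ'(s)| ds
is pushed forward to at most m + 2 copies of Lebesgue measure (`lintegral_tube_le`). External and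
screening points thus become points of one Lorentzian cylinder and are integrated jointly.

What remains is a product of exponential weights and powers of inverse scales, each scale involving
only points of the other charge class. The inequality XY ≤ X² + Y² leaves factors of a single class,
with exponents 2a² (`ofReal_prod_scaleProd_le`); given the other class, its points can be integrated
one at a time. Each integral factorizes into light-cone coordinates with singularities |θ|^(-γ), and
γ < 1 is possible exactly because every charge is smaller than 1/√2 in modulus. Convergence for
almost every external configuration follows from the joint integral by Tonelli. -/

theorem sum_mul_min_nonneg (x A : P → ℝ) (hA : ∀ p, 0 ≤ A p) :
    0 ≤ ∑ p, ∑ q, x p * x q * min (A p) (A q) := by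
  classical
  have hint : ∀ a b : ℝ, 0 ≤ a → 0 ≤ b →
      Integrable (fun t : ℝ => (Set.Ioc 0 (min a b)).indicator (fun _ => (1 : ℝ)) t) ∧
      ∫ t : ℝ, (Set.Ioc 0 (min a b)).indicator (fun _ => (1 : ℝ)) t = min a b := by
    intro a b ha hb
    refine ⟨(integrable_indicator_iff measurableSet_Ioc).2 (by simp), ?_⟩
    rw [integral_indicator measurableSet_Ioc]
    simp [ha, hb]
  -- The kernel `min` is a Gram kernel: min(A, B) is the L² inner product of the indicators of (0,
  -- A] and (0, B].
  have key : ∑ p, ∑ q, x p * x q * min (A p) (A q) =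
      ∫ t : ℝ, (∑ p, x p * (Set.Ioc 0 (A p)).indicator (fun _ => (1 : ℝ)) t) ^ 2 := by
    have hexp : ∀ t : ℝ, (∑ p, x p * (Set.Ioc 0 (A p)).indicator (fun _ => (1 : ℝ)) t) ^ 2 =
        ∑ p, ∑ q, x p * x q * (Set.Ioc 0 (min (A p) (A q))).indicator (fun _ => (1 : ℝ)) t := by
      intro t
      rw [sq, Finset.sum_mul_sum]
      refine Finset.sum_congr rfl fun p _ => Finset.sum_congr rfl fun q _ => ?_
      simp only [Set.indicator_apply, Set.mem_Ioc, le_min_iff]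
      split_ifs <;> first | tauto | ring
    simp_rw [hexp]
    rw [integral_finsetSum _ fun p _ => integrable_finsetSum _ fun q _ =>
      ((hint _ _ (hA p) (hA q)).1.const_mul _)]
    refine Finset.sum_congr rfl fun p _ => ?_
    rw [integral_finsetSum _ fun q _ => ((hint _ _ (hA p) (hA q)).1.const_mul _)]
    refine Finset.sum_congr rfl fun q _ => ?_
    rw [integral_const_mul, (hint _ _ (hA p) (hA q)).2]
  rw [key]
  exact integral_nonneg fun t => sq_nonneg _

theorem sum_re_mul_min_nonneg (c : P → ℂ) (A : P → ℝ) (hA : ∀ p, 0 ≤ A p) :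
    0 ≤ ∑ p, ∑ q, (c p * (starRingEnd ℂ) (c q)).re * min (A p) (A q) := by
  have h : ∀ p q, (c p * (starRingEnd ℂ) (c q)).re * min (A p) (A q) =
      (c p).re * (c q).re * min (A p) (A q) + (c p).im * (c q).im * min (A p) (A q) := by
    intro p q
    simp [Complex.mul_re]
    ring
  simp_rw [h, Finset.sum_add_distrib]
  exact add_nonneg (sum_mul_min_nonneg _ A hA) (sum_mul_min_nonneg _ A hA)

/-- The chiral coordinate `e^{-|S - T|} e \bar{e'}` of two points at Euclidean heights `S, T`
with phases `e, e'`. -/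
def chiralRatio (S T : ℝ) (e e' : ℂ) : ℂ :=
  (Real.exp (-|S - T|) : ℂ) * (e * (starRingEnd ℂ) e')

theorem norm_chiralRatio (S T : ℝ) {e e' : ℂ} (he : ‖e‖ = 1) (he' : ‖e'‖ = 1) :
    ‖chiralRatio S T e e'‖ = Real.exp (-|S - T|) := by
  simp [chiralRatio, he, he', -Complex.ofReal_exp, abs_of_pos (Real.exp_pos _)]

theorem exp_neg_abs_sub_pow (S T : ℝ) (n : ℕ) :
    Real.exp (-|S - T|) ^ n =
      Real.exp (-(n * S)) * Real.exp (-(n * T)) *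
        min (Real.exp (2 * n * S)) (Real.exp (2 * n * T)) := by
  rw [← Real.exp_nat_mul, ← Real.exp_monotone.map_min, ← Real.exp_add, ← Real.exp_add]
  congr 1
  have hn : (0 : ℝ) ≤ 2 * n := by positivity
  rw [← mul_min_of_nonneg _ _ hn]
  rcases le_total S T with h | h
  · rw [abs_of_nonpos (by linarith), min_eq_left h]; ring
  · rw [abs_of_nonneg (by linarith), min_eq_right h]; ring

/-- Expanding -log(1 - z) in powers of z, the n-th term contains e^{-n|S-T|} = e^{-nS} e^{-nT}
min(e^{2nS}, e^{2nT}), a rescaled `min` kernel, while the phases and dampings factor over the two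
points. Each term is thus positive semidefinite; the damping by ε makes the series converge,
including on the diagonal. -/
theorem sum_log_regularized_nonneg (a T ε : P → ℝ) (e : P → ℂ) (he : ∀ p, ‖e p‖ = 1)
    (hε : ∀ p, 0 < ε p) :
    0 ≤ ∑ p, ∑ q, a p * a q * (-Real.log
      ‖1 - (Real.exp (-(ε p + ε q)) : ℂ) * chiralRatio (T p) (T q) (e p) (e q)‖) := by
  set z : P → P → ℂ := fun p q =>
    (Real.exp (-(ε p + ε q)) : ℂ) * chiralRatio (T p) (T q) (e p) (e q) with hz
  have hzn : ∀ p q, ‖z p q‖ < 1 := by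
    intro p q
    simp only [hz, norm_mul, norm_chiralRatio _ _ (he p) (he q), Complex.norm_real, Real.norm_eq_abs,
      abs_of_pos (Real.exp_pos _), ← Real.exp_add]
    rw [Real.exp_lt_one_iff]
    have := hε p; have := hε q; have := abs_nonneg (T p - T q)
    linarith
  have hs : ∀ p q, HasSum (fun n : ℕ => a p * a q * (z p q ^ n / n).re)
      (a p * a q * (-Real.log ‖1 - z p q‖)) := by
    intro p q
    have := Complex.hasSum_re (Complex.hasSum_taylorSeries_neg_log (hzn p q))
    simp only [Complex.neg_re, Complex.log_re] at this
    exact this.mul_left _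
  have hs2 := hasSum_sum (s := Finset.univ) fun p (_ : p ∈ Finset.univ) =>
    hasSum_sum (s := Finset.univ) fun q (_ : q ∈ Finset.univ) => hs p q
  refine hs2.nonneg fun n => ?_
  set c : P → ℂ := fun p => ((a p * Real.exp (-(n * ε p)) * Real.exp (-(n * T p)) : ℝ) : ℂ) * e p ^ n
  have h : ∀ p q, a p * a q * (z p q ^ n / n).re = (1 / n : ℝ) *
      ((c p * (starRingEnd ℂ) (c q)).re *
        min (Real.exp (2 * n * T p)) (Real.exp (2 * n * T q))) := by
    intro p q
    have h1 : z p q ^ n = ((Real.exp (-(n * ε p)) * Real.exp (-(n * ε q)) *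
        Real.exp (-|T p - T q|) ^ n : ℝ) : ℂ) * (e p ^ n * (starRingEnd ℂ) (e q ^ n)) := by
      simp only [hz, chiralRatio]
      have : Real.exp (-(n * ε p)) * Real.exp (-(n * ε q)) = Real.exp (-(ε p + ε q)) ^ n := by
        rw [← Real.exp_nat_mul, ← Real.exp_add]; congr 1; ring
      rw [this]
      push_cast [map_pow]
      ring
    have h2 : c p * (starRingEnd ℂ) (c q) =
        ((a p * Real.exp (-(n * ε p)) * Real.exp (-(n * T p)) *
          (a q * Real.exp (-(n * ε q)) * Real.exp (-(n * T q))) : ℝ) : ℂ) *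
          (e p ^ n * (starRingEnd ℂ) (e q ^ n)) := by
      simp only [c, map_mul, Complex.conj_ofReal]
      push_cast
      ring
    have h3 : (z p q ^ n / n).re = (z p q ^ n).re / n := by
      rw [← Complex.ofReal_natCast, Complex.div_ofReal_re]
    rw [h3, h1, h2, Complex.re_ofReal_mul, Complex.re_ofReal_mul, exp_neg_abs_sub_pow]
    ring
  simp_rw [h, ← Finset.mul_sum]
  exact mul_nonneg (by positivity) (sum_re_mul_min_nonneg c _ fun p => (Real.exp_pos _).le)

/-- **Electrostatic inequality.** The chiral interaction energy of a charge distribution is bounded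
below by self-energies of the charges smeared at scales `ε p`, where `ε p` must not exceed the
distance of `p` to the charges of opposite sign. -/
theorem sum_log_chiral_le (a T ε : P → ℝ) (e : P → ℂ) (he : ∀ p, ‖e p‖ = 1)
    (hε : ∀ p, 0 < ε p) (hε1 : ∀ p, ε p ≤ 1)
    (hopp : ∀ p q, a p * a q < 0 → ε p ≤ ‖1 - chiralRatio (T p) (T q) (e p) (e q)‖ ∧
      ε q ≤ ‖1 - chiralRatio (T p) (T q) (e p) (e q)‖)
    (hne : ∀ p q, p ≠ q → 1 - chiralRatio (T p) (T q) (e p) (e q) ≠ 0) :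
    ∑ p, ∑ q, a p * a q * Real.log ‖1 - chiralRatio (T p) (T q) (e p) (e q)‖ ≤
      (∑ p, ∑ q, |a p * a q| * Real.log 3) - ∑ p, a p ^ 2 * Real.log (ε p) := by
  classical
  have hpos := sum_log_regularized_nonneg a T ε e he hε
  -- Termwise comparison with the regularized kernel at the cost of log 3. For opposite charges the
  -- regularized distance is at most |1 - w| + ε_p + ε_q ≤ 3|1 - w|; for like charges the reverse
  -- comparison needs no condition on ε.
  have hterm : ∀ p q, a p * a q * Real.log ‖1 - chiralRatio (T p) (T q) (e p) (e q)‖ ≤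
      |a p * a q| * Real.log 3 - (if p = q then a p ^ 2 * Real.log (ε p) else 0) +
      a p * a q * Real.log ‖1 - (Real.exp (-(ε p + ε q)) : ℂ) *
        chiralRatio (T p) (T q) (e p) (e q)‖ := by
    intro p q
    set w := chiralRatio (T p) (T q) (e p) (e q) with hw
    set r := Real.exp (-(ε p + ε q)) with hr
    have hr1 : r < 1 := by rw [hr, Real.exp_lt_one_iff]; linarith [hε p, hε q]
    have hr0 : 0 < r := Real.exp_pos _
    have hrε : 1 - r ≤ ε p + ε q := by
      have := Real.add_one_le_exp (-(ε p + ε q)); linarith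
    have hwn : ‖w‖ ≤ 1 := by
      rw [hw, norm_chiralRatio _ _ (he p) (he q), Real.exp_le_one_iff]
      simp
    have hrw : ‖(r : ℂ) * w‖ ≤ r := by
      rw [norm_mul, Complex.norm_real, Real.norm_eq_abs, abs_of_pos hr0]
      nlinarith
    have hlow : 1 - r ≤ ‖1 - (r : ℂ) * w‖ := by
      have := norm_sub_norm_le (1 : ℂ) ((r : ℂ) * w)
      rw [norm_one] at this; linarith
    have hdiff : ‖w - (r : ℂ) * w‖ ≤ 1 - r := by
      have : w - (r : ℂ) * w = ((1 - r : ℝ) : ℂ) * w := by push_cast; ring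
      rw [this, norm_mul, Complex.norm_real, Real.norm_eq_abs, abs_of_pos (by linarith)]
      nlinarith
    by_cases hpq : p = q
    -- On the diagonal the left side is zero by the convention log 0 = 0, while the regularized term
    -- supplies the self-energy log(ε/3).
    · subst hpq
      have hw1 : w = 1 := by
        rw [hw, chiralRatio, Complex.mul_conj, Complex.normSq_eq_norm_sq, he]; simp
      have hEp : ε p / 3 ≤ ‖1 - (r : ℂ) * w‖ := by
        refine le_trans ?_ hlow
        have h1 : 1 + ε p ≤ Real.exp (ε p + ε p) := by
          have := Real.add_one_le_exp (ε p + ε p); linarith [hε p]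
        have h2 : r ≤ 1 / (1 + ε p) := by
          rw [hr, Real.exp_neg, ← one_div]
          exact one_div_le_one_div_of_le (by linarith [hε p]) h1
        have h3 : 1 / (1 + ε p) ≤ 1 - ε p / 3 := by
          rw [div_le_iff₀ (by linarith [hε p])]
          nlinarith [hε p, hε1 p]
        linarith
      have hl := Real.log_le_log (by linarith [hε p]) hEp
      rw [Real.log_div (hε p).ne' (by norm_num)] at hl
      have : 0 ≤ a p ^ 2 := sq_nonneg _
      have hab : |a p * a p| = a p ^ 2 := by rw [← sq, abs_of_nonneg this]
      simp only [hw1, sub_self, norm_zero, Real.log_zero, mul_zero, if_true, hab]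
      rw [hw1] at hl
      nlinarith
    · have hwne : 0 < ‖1 - w‖ := norm_pos_iff.2 (hne p q hpq)
      have hrpos : 0 < ‖1 - (r : ℂ) * w‖ := lt_of_lt_of_le (by linarith) hlow
      simp only [hpq, if_false, sub_zero]
      rcases lt_or_ge (a p * a q) 0 with hneg | hnn
      · have h1 : ‖1 - (r : ℂ) * w‖ ≤ 3 * ‖1 - w‖ := by
          have : 1 - (r : ℂ) * w = (1 - w) + (w - (r : ℂ) * w) := by ring
          rw [this]
          refine (norm_add_le _ _).trans ?_
          obtain ⟨h1, h2⟩ := hopp p q hneg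
          linarith
        have hl := Real.log_le_log hrpos h1
        rw [Real.log_mul (by norm_num) hwne.ne'] at hl
        rw [abs_of_neg hneg]
        nlinarith
      · have h1 : ‖1 - w‖ ≤ 3 * ‖1 - (r : ℂ) * w‖ := by
          have : 1 - w = (1 - (r : ℂ) * w) - (w - (r : ℂ) * w) := by ring
          rw [this]
          refine (norm_sub_le _ _).trans ?_
          linarith
        have hl := Real.log_le_log hwne h1
        rw [Real.log_mul (by norm_num) hrpos.ne'] at hl
        rw [abs_of_nonneg hnn]
        nlinarith
  have hsum := Finset.sum_le_sum fun p (_ : p ∈ Finset.univ) =>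
    Finset.sum_le_sum fun q (_ : q ∈ Finset.univ) => hterm p q
  simp only [Finset.sum_add_distrib, Finset.sum_sub_distrib, Finset.sum_ite_eq, Finset.mem_univ,
    if_true] at hsum
  simp only [mul_neg, Finset.sum_neg_distrib] at hpos
  linarith

end Electrostatics

/-! ### Light-cone coordinates and the Green's function -/

theorem circleChar_add (x y : AddCircle (2 : ℝ)) :
    circleChar (x + y) = circleChar x * circleChar y := by
  simp [circleChar, AddCircle.toCircle_add]

theorem norm_circleChar (x : AddCircle (2 : ℝ)) : ‖circleChar x‖ = 1 :=
  Circle.norm_coe _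

theorem circleChar_neg (x : AddCircle (2 : ℝ)) :
    circleChar (-x) = (starRingEnd ℂ) (circleChar x) := by
  rw [circleChar, AddCircle.toCircle_neg, Circle.coe_inv_eq_conj, circleChar]

theorem circleChar_sub (x y : AddCircle (2 : ℝ)) :
    circleChar (x - y) = circleChar x * (starRingEnd ℂ) (circleChar y) := by
  rw [sub_eq_add_neg, circleChar_add, circleChar_neg]

theorem continuous_circleChar : Continuous circleChar :=
  continuous_subtype_val.comp AddCircle.continuous_toCircle

theorem circleChar_injective : Function.Injective circleChar :=
  Subtype.val_injective.comp (AddCircle.injective_toCircle (by norm_num))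

theorem circleChar_zero : circleChar 0 = 1 := by simp [circleChar]

/-- Right-moving light-cone coordinate (of the real part of time). -/
def coneAdd (p : ℂ × AddCircle (2 : ℝ)) : AddCircle (2 : ℝ) := (p.1.im : AddCircle (2 : ℝ)) + p.2

/-- Left-moving light-cone coordinate (of the real part of time). -/
def coneSub (p : ℂ × AddCircle (2 : ℝ)) : AddCircle (2 : ℝ) := (p.1.im : AddCircle (2 : ℝ)) - p.2

/-- The chiral ratio of two points in terms of their Euclidean heights and of one of their
light-cone coordinates. -/
def coneRatio (κ : ℂ × AddCircle (2 : ℝ) → AddCircle (2 : ℝ)) (p q : ℂ × AddCircle (2 : ℝ)) : ℂ :=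
  chiralRatio (Real.pi * p.1.re) (Real.pi * q.1.re) (circleChar (κ p)) (circleChar (κ q))

theorem chiralRatio_swap (S T : ℝ) (e e' : ℂ) :
    chiralRatio S T e e' = (starRingEnd ℂ) (chiralRatio T S e' e) := by
  simp [chiralRatio, abs_sub_comm S T, mul_comm, -Complex.ofReal_exp]

theorem norm_one_sub_coneRatio_comm (κ : ℂ × AddCircle (2 : ℝ) → AddCircle (2 : ℝ))
    (p q : ℂ × AddCircle (2 : ℝ)) : ‖1 - coneRatio κ p q‖ = ‖1 - coneRatio κ q p‖ := by
  rw [coneRatio, chiralRatio_swap, ← Complex.norm_conj]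
  simp [coneRatio]

theorem coneRatio_self (κ : ℂ × AddCircle (2 : ℝ) → AddCircle (2 : ℝ))
    (p : ℂ × AddCircle (2 : ℝ)) : coneRatio κ p p = 1 := by
  simp [coneRatio, chiralRatio, Complex.mul_conj, Complex.normSq_eq_norm_sq, norm_circleChar]

/-- Twice the interaction energy of two unit charges (with the sign of the exponent). -/
def pairEnergy (p q : ℂ × AddCircle (2 : ℝ)) : ℝ :=
  Real.pi * |p.1.re - q.1.re| + Real.log ‖1 - coneRatio coneAdd p q‖ +
    Real.log ‖1 - coneRatio coneSub p q‖

theorem pairEnergy_comm (p q : ℂ × AddCircle (2 : ℝ)) : pairEnergy p q = pairEnergy q p := by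
  simp only [pairEnergy, abs_sub_comm p.1.re, norm_one_sub_coneRatio_comm _ p q]

theorem pairEnergy_self (p : ℂ × AddCircle (2 : ℝ)) : pairEnergy p p = 0 := by
  simp [pairEnergy, coneRatio_self]

/-- The imaginary part of the time difference is a phase, which merges with the space coordinate
into a light-cone coordinate; only the real part damps. Applied with both signs of the space
coordinates, it treats both logarithms of the Green's function. -/
theorem exp_mul_circleChar_sub (p q : ℂ × AddCircle (2 : ℝ)) (h : p.1.re ≤ q.1.re)
    (x y : AddCircle (2 : ℝ)) :
    Complex.exp (-(Real.pi * (q.1 - p.1))) * circleChar (y - x) =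
      chiralRatio (Real.pi * p.1.re) (Real.pi * q.1.re)
        (circleChar ((p.1.im : AddCircle (2 : ℝ)) - x))
        (circleChar ((q.1.im : AddCircle (2 : ℝ)) - y)) := by
  have h1 : Complex.exp (-(Real.pi * (q.1 - p.1))) =
      (Real.exp (-|Real.pi * p.1.re - Real.pi * q.1.re|) : ℂ) *
        circleChar (((p.1.im - q.1.im : ℝ)) : AddCircle (2 : ℝ)) := by
    rw [circleChar_coe, Complex.ofReal_exp, ← Complex.exp_add]
    congr 1
    rw [← mul_sub, abs_mul, abs_of_pos Real.pi_pos, abs_of_nonpos (by linarith)]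
    apply Complex.ext <;> simp
    ring
  rw [h1, chiralRatio, mul_assoc, ← circleChar_sub, ← circleChar_add]
  congr 2
  rw [AddCircle.coe_sub]
  abel

theorem green_sub_re (p q : ℂ × AddCircle (2 : ℝ)) (h : p.1.re ≤ q.1.re) :
    (green (q - p)).re = -(1 / 2) * pairEnergy p q := by
  have h1 := exp_mul_circleChar_sub p q h p.2 q.2
  have h3 : -(q.2 - p.2) = -q.2 - -p.2 := by abel
  simp only [green, Prod.fst_sub, Prod.snd_sub, h1, h3, pairEnergy]
  rw [exp_mul_circleChar_sub p q h (-p.2) (-q.2)]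
  simp only [sub_neg_eq_add]
  have h4 : ∀ z : ℂ, (1 / 2 * z).re = 1 / 2 * z.re := by intro z; simp
  rw [Complex.sub_re, Complex.sub_re, h4, h4, Complex.log_re, Complex.log_re, abs_of_nonpos (by linarith)]
  simp only [coneRatio, coneAdd, coneSub]
  simp
  ring

theorem green_timeOrdered_re (s s' : ℝ) (p p' : ℂ × AddCircle (2 : ℝ))
    (h : s' ≤ s → p'.1.re ≤ p.1.re) (h' : s ≤ s' → p.1.re ≤ p'.1.re) :
    (green (timeOrdered s s' p p')).re = -(1 / 2) * pairEnergy p p' := by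
  unfold timeOrdered
  split_ifs with hs
  · rw [green_sub_re _ _ (h hs), pairEnergy_comm]
  · rw [green_sub_re _ _ (h' (le_of_not_ge hs))]

/-! ### The modulus of the integrand as an interaction energy -/

theorem contour_re {m : ℕ} (t : Fin (m + 1) → ℝ) (s : ℝ) :
    (contour t s).re = min s 0 + max (s - m) 0 := by
  simp [contour, -Complex.ofReal_add, -Complex.ofReal_sum, -Complex.ofReal_mul]

theorem contour_im {m : ℕ} (t : Fin (m + 1) → ℝ) (s : ℝ) :
    (contour t s).im =
      t 0 + ∑ j : Fin m, max 0 (min 1 (s - (j : ℕ))) * (t j.succ - t j.castSucc) := by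
  simp [contour, -Complex.ofReal_add, -Complex.ofReal_sum, -Complex.ofReal_mul]

theorem contour_re_mono {m : ℕ} (t : Fin (m + 1) → ℝ) {s s' : ℝ} (h : s ≤ s') :
    (contour t s).re ≤ (contour t s').re := by
  rw [contour_re, contour_re]
  gcongr

theorem contour_re_natCast {m : ℕ} (t : Fin (m + 1) → ℝ) (j : Fin (m + 1)) :
    (contour t (j : ℕ)).re = 0 := by
  rw [contour_re]
  have : ((j : ℕ) : ℝ) ≤ m := by exact_mod_cast Nat.lt_succ_iff.1 j.2
  rw [min_eq_right (by positivity), max_eq_right (by linarith), add_zero]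

theorem external_re {m : ℕ} (u : Fin (m + 1) → Cylinder) (j : Fin (m + 1)) :
    (external u j).1.re = 0 := by simp [external]

theorem external_im {m : ℕ} (u : Fin (m + 1) → Cylinder) (j : Fin (m + 1)) :
    (external u j).1.im = (u j).1 := by simp [external]

/-- All insertions: the external ones and the screening ones. -/
def insertions {m w : ℕ} (u : Fin (m + 1) → Cylinder) (z : Fin w → ℝ × AddCircle (2 : ℝ)) :
    Fin (m + 1) ⊕ Fin w → ℂ × AddCircle (2 : ℝ) :=
  Sum.elim (external u) (fun l => tubePoint u (z l))

/-- The real charges of all insertions. -/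
def allCharges {m : ℕ} (b : ℝ) (n : Fin (m + 1) → ℤ) (w : ℕ) : Fin (m + 1) ⊕ Fin w → ℝ :=
  Sum.elim (fun j => b * n j) (fun _ => b)

theorem sum_sum_eq_two_mul_Ioi {N : ℕ} (f : Fin N → Fin N → ℝ) (h : ∀ i j, f i j = f j i)
    (h0 : ∀ i, f i i = 0) : ∑ i, ∑ j, f i j = 2 * ∑ i, ∑ j ∈ Finset.Ioi i, f i j := by
  have h1 : ∀ i j, f i j = (if i < j then f i j else 0) + (if j < i then f j i else 0) := by
    intro i j
    rcases lt_trichotomy i j with hij | hij | hij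
    · simp [hij, hij.not_gt]
    · simp [hij, h0]
    · simp [hij, hij.not_gt, h i j]
  have h2 : ∑ i, ∑ j, (if j < i then f j i else 0) = ∑ i, ∑ j, (if i < j then f i j else 0) :=
    Finset.sum_comm
  have h3 : ∀ i, ∑ j ∈ Finset.Ioi i, f i j = ∑ j, (if i < j then f i j else 0) := by
    intro i
    rw [← Finset.sum_filter]
    congr 1
    ext j; simp
  calc ∑ i, ∑ j, f i j
      = ∑ i, ∑ j, ((if i < j then f i j else 0) + (if j < i then f j i else 0)) :=
        Finset.sum_congr rfl fun i _ => Finset.sum_congr rfl fun j _ => h1 i j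
    _ = _ := by
        simp only [Finset.sum_add_distrib, h2, h3]; ring

/-- The factor -4 against Re g = -E/2 gives 2 per unordered pair, hence 1 per ordered pair.
Self-terms may be added because log 0 = 0 makes `pairEnergy_self` vanish, and for the same reason
coincident points need not be excluded. -/
theorem norm_freeFactor_mul_norm_screeningIntegrand {m w : ℕ} (b : ℝ) (n : Fin (m + 1) → ℤ)
    (u : Fin (m + 1) → Cylinder) (z : Fin w → ℝ × AddCircle (2 : ℝ)) :
    ‖freeFactor (charge b n) u‖ * ‖screeningIntegrand b w (charge b n) u z‖ =
      Real.exp (∑ p, ∑ q, allCharges b n w p * allCharges b n w q *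
        pairEnergy (insertions u z p) (insertions u z q)) *
      ∏ l, ‖deriv (contour (fun j => (u j).1)) (z l).1‖ := by
  have hee : ∀ j j' : Fin (m + 1), (green (timeOrdered (j : ℕ) (j' : ℕ) (external u j)
      (external u j'))).re = -(1 / 2) * pairEnergy (external u j) (external u j') := by
    intro j j'
    apply green_timeOrdered_re <;> simp [external_re]
  have hes : ∀ (j : Fin (m + 1)) (l : Fin w), (green (timeOrdered (j : ℕ) (z l).1 (external u j)
      (tubePoint u (z l)))).re = -(1 / 2) * pairEnergy (external u j) (tubePoint u (z l)) := by
    intro j l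
    apply green_timeOrdered_re
    · intro h
      rw [external_re, ← contour_re_natCast (fun j => (u j).1) j]
      exact contour_re_mono _ h
    · intro h
      rw [external_re, ← contour_re_natCast (fun j => (u j).1) j]
      exact contour_re_mono _ h
  have hss : ∀ l l' : Fin w, (green (timeOrdered (z l).1 (z l').1 (tubePoint u (z l))
      (tubePoint u (z l')))).re =
        -(1 / 2) * pairEnergy (tubePoint u (z l)) (tubePoint u (z l')) := by
    intro l l'
    apply green_timeOrdered_re
    · exact fun h => contour_re_mono _ h
    · exact fun h => contour_re_mono _ h
  have hc : ∀ j, charge b n j = ((b * n j : ℝ) : ℂ) := by intro j; simp [charge]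
  rw [freeFactor, screeningIntegrand, norm_mul, Complex.norm_exp, Complex.norm_exp, norm_prod,
    ← mul_assoc, ← Real.exp_add]
  congr 2
  have e1 : (-4 * ∑ j : Fin (m + 1), ∑ j' ∈ Finset.Ioi j, charge b n j * charge b n j' *
      green (timeOrdered (j : ℕ) (j' : ℕ) (external u j) (external u j'))).re =
      2 * ∑ j : Fin (m + 1), ∑ j' ∈ Finset.Ioi j, (b * n j) * (b * n j') *
        pairEnergy (external u j) (external u j') := by
    rw [show (-4 : ℂ) = ((-4 : ℝ) : ℂ) by norm_num, Complex.re_ofReal_mul]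
    simp only [Complex.re_sum, hc, ← Complex.ofReal_mul, Complex.re_ofReal_mul, hee,
      Finset.mul_sum]
    refine Finset.sum_congr rfl fun j _ => Finset.sum_congr rfl fun j' _ => ?_
    ring
  have e2 : (-4 * (b : ℂ) * ∑ j : Fin (m + 1), ∑ l : Fin w, charge b n j *
      green (timeOrdered (j : ℕ) (z l).1 (external u j) (tubePoint u (z l)))).re =
      2 * ∑ j : Fin (m + 1), ∑ l : Fin w, (b * n j) * b *
        pairEnergy (external u j) (tubePoint u (z l)) := by
    rw [show (-4 * b : ℂ) = ((-4 * b : ℝ) : ℂ) by push_cast; ring, Complex.re_ofReal_mul]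
    simp only [Complex.re_sum, hc, Complex.re_ofReal_mul, hes, Finset.mul_sum]
    refine Finset.sum_congr rfl fun j _ => Finset.sum_congr rfl fun j' _ => ?_
    ring
  have e3 : (4 * (b : ℂ) ^ 2 * ∑ l : Fin w, ∑ l' ∈ Finset.Ioi l,
      green (timeOrdered (z l).1 (z l').1 (tubePoint u (z l)) (tubePoint u (z l')))).re =
      -(2 * ∑ l : Fin w, ∑ l' ∈ Finset.Ioi l, b * b *
        pairEnergy (tubePoint u (z l)) (tubePoint u (z l'))) := by
    rw [show (4 * (b : ℂ) ^ 2) = ((4 * b ^ 2 : ℝ) : ℂ) by push_cast; ring, Complex.re_ofReal_mul]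
    simp only [Complex.re_sum, hss, Finset.mul_sum, ← Finset.sum_neg_distrib]
    refine Finset.sum_congr rfl fun j _ => Finset.sum_congr rfl fun j' _ => ?_
    ring
  rw [Complex.sub_re, e1, e2, e3]
  simp only [Fintype.sum_sum_type, allCharges, insertions, Sum.elim_inl, Sum.elim_inr]
  rw [← sum_sum_eq_two_mul_Ioi (fun j j' => (b * n j) * (b * n j') *
        pairEnergy (external u j) (external u j')) (fun i j => by
          simp only [pairEnergy_comm (external u i)]; ring) (fun i => by simp [pairEnergy_self]),
    ← sum_sum_eq_two_mul_Ioi (fun l l' => b * b *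
        pairEnergy (tubePoint u (z l)) (tubePoint u (z l'))) (fun i j => by
          simp only [pairEnergy_comm (tubePoint u (z i))]) (fun i => by simp [pairEnergy_self])]
  have e4 : ∑ l : Fin w, ∑ j : Fin (m + 1), b * (b * n j) *
      pairEnergy (tubePoint u (z l)) (external u j) =
      ∑ j : Fin (m + 1), ∑ l : Fin w, (b * n j) * b *
        pairEnergy (external u j) (tubePoint u (z l)) := by
    rw [Finset.sum_comm]
    refine Finset.sum_congr rfl fun j _ => Finset.sum_congr rfl fun l _ => ?_
    rw [pairEnergy_comm]; ring
  simp only [Finset.sum_add_distrib]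
  rw [e4]
  ring

/-- Neutrality makes the linear part of the interaction confining. -/
theorem sum_charges_mul_abs_sub_le {m w : ℕ} (b : ℝ) (n : Fin (m + 1) → ℤ)
    (hw : (w : ℤ) = -∑ j, n j) (T : Fin w → ℝ) :
    ∑ p, ∑ q, allCharges b n w p * allCharges b n w q *
      |Sum.elim (fun _ => (0 : ℝ)) T p - Sum.elim (fun _ => (0 : ℝ)) T q| ≤
      -(2 * b ^ 2 * ∑ l, |T l|) := by
  have hw' : (∑ j, (n j : ℝ)) = -(w : ℝ) := by
    have : (w : ℝ) = -∑ j, (n j : ℝ) := by exact_mod_cast hw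
    linarith
  set A := ∑ l, |T l| with hA
  have h1 : ∑ j : Fin (m + 1), ∑ l : Fin w, (b * n j) * b * |0 - T l| = -(w * b ^ 2 * A) := by
    have : ∀ (j : Fin (m + 1)) (l : Fin w), (b * n j) * b * |0 - T l| =
        n j * (b ^ 2 * |T l|) := by
      intro j l; rw [zero_sub, abs_neg]; ring
    simp_rw [this]
    rw [← Finset.sum_mul_sum, ← Finset.mul_sum, hw']
    ring
  have h1' : ∑ l : Fin w, ∑ j : Fin (m + 1), b * (b * n j) * |T l - 0| = -(w * b ^ 2 * A) := by
    rw [← h1, Finset.sum_comm]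
    refine Finset.sum_congr rfl fun j _ => Finset.sum_congr rfl fun l _ => ?_
    rw [abs_sub_comm]; ring
  -- The triangle inequality alone would exactly cancel the attraction to the external charges; the
  -- net decay comes from the diagonal, where the left side is zero.
  have h2 : ∑ l : Fin w, ∑ l' : Fin w, b * b * |T l - T l'| ≤
      ∑ l : Fin w, ∑ l' : Fin w, (b ^ 2 * (|T l| + |T l'|) -
        if l = l' then 2 * b ^ 2 * |T l| else 0) := by
    refine Finset.sum_le_sum fun l _ => Finset.sum_le_sum fun l' _ => ?_
    split_ifs with hl
    · subst hl; simp; linarith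
    · have := abs_sub (T l) (T l')
      have hb : 0 ≤ b ^ 2 := sq_nonneg b
      nlinarith
  have h3 : ∑ l : Fin w, ∑ l' : Fin w, (b ^ 2 * (|T l| + |T l'|) -
        if l = l' then 2 * b ^ 2 * |T l| else 0) = 2 * (w * b ^ 2 * A) - 2 * b ^ 2 * A := by
    simp only [Finset.sum_sub_distrib, Finset.sum_ite_eq, Finset.mem_univ, if_true, mul_add,
      Finset.sum_add_distrib, ← Finset.mul_sum, Finset.sum_const, Finset.card_univ,
      Fintype.card_fin, nsmul_eq_mul, ← hA]
    ring
  simp only [Fintype.sum_sum_type, allCharges, Sum.elim_inl, Sum.elim_inr,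
    Finset.sum_add_distrib, h1, h1', sub_self, abs_zero, mul_zero, Finset.sum_const_zero]
  linarith

/-! ### Rotating the horizontal parts of the contour to real time -/

/-- Chordal distance of a point of the circle to `0`. -/
def chord (θ : AddCircle (2 : ℝ)) : ℝ := ‖1 - circleChar θ‖

theorem chord_nonneg (θ : AddCircle (2 : ℝ)) : 0 ≤ chord θ := norm_nonneg _

theorem continuous_chord : Continuous chord := (continuous_const.sub continuous_circleChar).norm

theorem chord_le_two (θ : AddCircle (2 : ℝ)) : chord θ ≤ 2 := by
  refine (norm_sub_le _ _).trans ?_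
  rw [norm_circleChar, norm_one]; norm_num

theorem chord_eq_zero {θ : AddCircle (2 : ℝ)} : chord θ = 0 ↔ θ = 0 := by
  rw [chord, norm_eq_zero, sub_eq_zero, eq_comm, ← circleChar_zero, circleChar_injective.eq_iff]

theorem chord_coe_le (a : ℝ) : chord (a : AddCircle (2 : ℝ)) ≤ Real.pi * |a| := by
  rw [chord, circleChar_coe, norm_sub_rev]
  have := Real.norm_exp_I_mul_ofReal_sub_one_le (x := Real.pi * a)
  rw [Real.norm_eq_abs, abs_mul, abs_of_pos Real.pi_pos] at this
  convert! this using 4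
  push_cast; ring

/-- Rotating a Euclidean time separation into a real one does not increase the chiral distance by
more than a constant. -/
theorem chord_add_le (a : ℝ) (θ : AddCircle (2 : ℝ)) :
    chord ((a : AddCircle (2 : ℝ)) + θ) ≤
      5 * ‖1 - (Real.exp (-(Real.pi * |a|)) : ℂ) * circleChar θ‖ := by
  set x := Real.pi * |a| with hx
  have hx0 : 0 ≤ x := by positivity
  set r := Real.exp (-x) with hr
  have hr0 : 0 < r := Real.exp_pos _
  have hr1 : r ≤ 1 := Real.exp_le_one_iff.2 (by linarith)
  have h1 : chord ((a : AddCircle (2 : ℝ)) + θ) ≤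
      ‖1 - (r : ℂ) * circleChar θ‖ + ((1 - r) + chord (a : AddCircle (2 : ℝ))) := by
    have e : 1 - circleChar ((a : AddCircle (2 : ℝ)) + θ) = (1 - (r : ℂ) * circleChar θ) +
        (-((1 - r : ℝ) : ℂ) + (1 - circleChar (a : AddCircle (2 : ℝ)))) * circleChar θ := by
      rw [circleChar_add]; push_cast; ring
    rw [chord, e]
    refine (norm_add_le _ _).trans ?_
    rw [norm_mul, norm_circleChar, mul_one]
    gcongr
    refine (norm_add_le _ _).trans ?_
    rw [norm_neg, Complex.norm_real, Real.norm_eq_abs, abs_of_nonneg (by linarith)]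
    rfl
  have h2 : 1 - r ≤ ‖1 - (r : ℂ) * circleChar θ‖ := by
    have := norm_sub_norm_le (1 : ℂ) ((r : ℂ) * circleChar θ)
    rw [norm_one, norm_mul, norm_circleChar, Complex.norm_real, Real.norm_eq_abs,
      abs_of_pos hr0, mul_one] at this
    exact this
  have h3 : r ≤ 1 / (1 + x) := by
    rw [hr, Real.exp_neg, ← one_div]
    refine one_div_le_one_div_of_le (by linarith) ?_
    linarith [Real.add_one_le_exp x]
  -- With 1 - r ≥ x/(1 + x), the bound chord ≤ x suffices for x ≤ 2 and chord ≤ 2 for x ≥ 2. The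
  -- final constant is 5 = 1 + 1 + 3.
  have h4 : chord (a : AddCircle (2 : ℝ)) ≤ 3 * (1 - r) := by
    have h5 : x / (1 + x) ≤ 1 - r := by
      have : x / (1 + x) = 1 - 1 / (1 + x) := by field_simp; ring
      linarith
    rcases le_total x 2 with h | h
    · refine (chord_coe_le a).trans ?_
      refine le_trans ?_ (mul_le_mul_of_nonneg_left h5 (by norm_num))
      rw [← hx, mul_div_assoc', le_div_iff₀ (by linarith)]
      nlinarith
    · refine (chord_le_two _).trans ?_
      refine le_trans ?_ (mul_le_mul_of_nonneg_left h5 (by norm_num))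
      rw [mul_div_assoc', le_div_iff₀ (by linarith)]
      nlinarith
  linarith

/-- Right-moving light-cone coordinate on the cylinder. -/
def cylAdd (x : Cylinder) : AddCircle (2 : ℝ) := (x.1 : AddCircle (2 : ℝ)) + x.2

/-- Left-moving light-cone coordinate on the cylinder. -/
def cylSub (x : Cylinder) : AddCircle (2 : ℝ) := (x.1 : AddCircle (2 : ℝ)) - x.2

/-- The point of the Lorentzian cylinder obtained by rotating Euclidean time into real time. -/
def rotate (p : ℂ × AddCircle (2 : ℝ)) : Cylinder := (p.1.re + p.1.im, p.2)

theorem rotate_external {m : ℕ} (u : Fin (m + 1) → Cylinder) (j : Fin (m + 1)) :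
    rotate (external u j) = u j := by
  simp [rotate, external]

theorem chord_cylAdd_le (p q : ℂ × AddCircle (2 : ℝ)) :
    chord (cylAdd (rotate p) - cylAdd (rotate q)) ≤ 5 * ‖1 - coneRatio coneAdd p q‖ := by
  convert! chord_add_le (p.1.re - q.1.re) (coneAdd p - coneAdd q) using 2
  · simp only [cylAdd, rotate, coneAdd, AddCircle.coe_add, AddCircle.coe_sub]; abel
  · rw [coneRatio, chiralRatio, circleChar_sub, ← mul_sub, abs_mul, abs_of_pos Real.pi_pos]

theorem chord_cylSub_le (p q : ℂ × AddCircle (2 : ℝ)) :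
    chord (cylSub (rotate p) - cylSub (rotate q)) ≤ 5 * ‖1 - coneRatio coneSub p q‖ := by
  convert! chord_add_le (p.1.re - q.1.re) (coneSub p - coneSub q) using 2
  · simp only [cylSub, rotate, coneSub, AddCircle.coe_add, AddCircle.coe_sub]; abel
  · rw [coneRatio, chiralRatio, circleChar_sub, ← mul_sub, abs_mul, abs_of_pos Real.pi_pos]

/-! ### Push-forward of the contour measure to real time -/

theorem lintegral_affine_le (A B : ℝ) {G : ℝ → ENNReal} (hG : Measurable G) (S : Set ℝ) :
    ∫⁻ s in S, ‖B‖ₑ * G (A + B * s) ≤ ∫⁻ t, G t := by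
  refine (setLIntegral_le_lintegral _ _).trans ?_
  by_cases hB : B = 0
  · simp [hB]
  · have hG' : Measurable fun x => G (A + x) := by fun_prop
    rw [lintegral_const_mul _ (by fun_prop)]
    have h1 : ∫⁻ s, G (A + B * s) = ∫⁻ x, G (A + x) ∂(Measure.map (B * ·) volume) :=
      (lintegral_map hG' (by fun_prop)).symm
    rw [h1, Real.map_volume_mul_left hB, lintegral_smul_measure, lintegral_add_left_eq_self,
      smul_eq_mul, ← mul_assoc, Real.enorm_eq_ofReal_abs, ← ENNReal.ofReal_mul (abs_nonneg _),
      ← abs_mul, mul_inv_cancel₀ hB]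
    simp

/-- On a horizontal or vertical piece the velocity d is real or purely imaginary, so |γ'| equals the
speed of the rotated time Re γ + Im γ. The two conditions on `d` and `B` record this. -/
theorem exists_affine_of_contour_eq {m : ℕ} {t : Fin (m + 1) → ℝ} {S : Set ℝ} (hS : IsOpen S)
    (c d : ℂ) (B : ℝ) (hd : ‖d‖ = |B|) (hdB : d.re + d.im = B)
    (h : ∀ s ∈ S, contour t s = c + d * s) {s : ℝ} (hs : s ∈ S) :
    ‖deriv (contour t) s‖ₑ = ‖B‖ₑ ∧
      (contour t s).re + (contour t s).im = (c.re + c.im) + B * s := by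
  constructor
  · have h1 : contour t =ᶠ[nhds s] fun s => c + d * s :=
      Filter.eventually_of_mem (hS.mem_nhds hs) h
    have h2 : HasDerivAt (fun s : ℝ => c + d * (s : ℂ)) d s := by
      simpa using! ((Complex.ofRealCLM.hasDerivAt (x := s)).const_mul d).const_add c
    rw [h1.deriv_eq, h2.deriv, ← ofReal_norm, ← ofReal_norm, hd,
      Real.norm_eq_abs]
  · rw [h s hs, ← hdB]
    simp
    ring

theorem lintegral_contour_piece_le {m : ℕ} {t : Fin (m + 1) → ℝ} {S : Set ℝ} (hS : IsOpen S)
    (c d : ℂ) (B : ℝ) (hd : ‖d‖ = |B|) (hdB : d.re + d.im = B)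
    (h : ∀ s ∈ S, contour t s = c + d * s) {G : ℝ → ENNReal} (hG : Measurable G) :
    ∫⁻ s in S, ‖deriv (contour t) s‖ₑ * G ((contour t s).re + (contour t s).im) ≤
      ∫⁻ x, G x := by
  refine le_trans (le_of_eq ?_) (lintegral_affine_le (c.re + c.im) B hG S)
  refine setLIntegral_congr_fun hS.measurableSet fun s hs => ?_
  obtain ⟨h1, h2⟩ := exists_affine_of_contour_eq hS c d B hd hdB h hs
  simp only [h1, h2]

theorem contour_eq_of_neg {m : ℕ} (t : Fin (m + 1) → ℝ) {s : ℝ} (hs : s < 0) :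
    contour t s = Complex.I * (t 0 : ℝ) + 1 * (s : ℂ) := by
  have h : ∀ j : Fin m, max 0 (min 1 (s - (j : ℕ))) = 0 := by
    intro j
    have : (0 : ℝ) ≤ (j : ℕ) := by positivity
    exact max_eq_left ((min_le_right _ _).trans (by linarith))
  have hm : (0 : ℝ) ≤ m := by positivity
  simp only [contour, h, zero_mul, Finset.sum_const_zero, add_zero, min_eq_left hs.le]
  rw [max_eq_right (by linarith)]
  push_cast; ring

theorem contour_eq_of_gt {m : ℕ} (t : Fin (m + 1) → ℝ) {s : ℝ} (hs : (m : ℝ) < s) :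
    contour t s = (-(m : ℂ) + Complex.I * ((t 0 + ∑ j : Fin m, (t j.succ - t j.castSucc) : ℝ))) +
      1 * (s : ℂ) := by
  have h : ∀ j : Fin m, max 0 (min 1 (s - (j : ℕ))) = 1 := by
    intro j
    have : ((j : ℕ) : ℝ) + 1 ≤ m := by exact_mod_cast j.2
    rw [min_eq_left (by linarith)]; norm_num
  have hm : (0 : ℝ) ≤ m := by positivity
  simp only [contour, h, one_mul]
  rw [min_eq_right (by linarith), max_eq_left (by linarith)]
  push_cast; ring

theorem contour_eq_of_mem {m : ℕ} (t : Fin (m + 1) → ℝ) (i : Fin m) {s : ℝ}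
    (hs : s ∈ Set.Ioo ((i : ℕ) : ℝ) ((i : ℕ) + 1)) :
    contour t s = (Complex.I * ((t 0 + ∑ j : Fin m, (if j < i then t j.succ - t j.castSucc else 0) -
      (i : ℕ) * (t i.succ - t i.castSucc) : ℝ))) +
      (Complex.I * ((t i.succ - t i.castSucc : ℝ))) * (s : ℂ) := by
  have h : ∀ j : Fin m, max 0 (min 1 (s - (j : ℕ))) * (t j.succ - t j.castSucc) =
      (if j < i then t j.succ - t j.castSucc else 0) +
      if j = i then (s - (i : ℕ)) * (t i.succ - t i.castSucc) else 0 := by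
    intro j
    rcases lt_trichotomy j i with hj | hj | hj
    · have h1 : ((j : ℕ) : ℝ) + 1 ≤ (i : ℕ) := by exact_mod_cast hj
      rw [min_eq_left (by linarith [hs.1])]
      simp [hj, hj.ne]
    · subst hj
      rw [min_eq_right (by linarith [hs.2]), max_eq_right (by linarith [hs.1])]
      simp
    · have h1 : ((i : ℕ) : ℝ) + 1 ≤ (j : ℕ) := by exact_mod_cast hj
      rw [min_eq_right (by linarith [hs.2]), max_eq_left (by linarith [hs.2])]
      simp [hj.not_gt, hj.ne']
  have h0 : (0 : ℝ) ≤ (i : ℕ) := by positivity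
  have hm : ((i : ℕ) : ℝ) + 1 ≤ m := by exact_mod_cast i.2
  simp only [contour, h, Finset.sum_add_distrib, Finset.sum_ite_eq', Finset.mem_univ, if_true]
  rw [min_eq_right (by linarith [hs.1]), max_eq_right (by linarith [hs.2])]
  push_cast; ring

/-- The contour has m + 2 affine pieces, and on each the change of variables to rotated time costs
at most one full Lebesgue integral. The corners lie at integer parameters, a null set. -/
theorem lintegral_contour_le {m : ℕ} (t : Fin (m + 1) → ℝ) {G : ℝ → ENNReal}
    (hG : Measurable G) :
    ∫⁻ s, ‖deriv (contour t) s‖ₑ * G ((contour t s).re + (contour t s).im) ≤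
      (m + 2) * ∫⁻ x, G x := by
  set F : ℝ → ENNReal := fun s =>
    ‖deriv (contour t) s‖ₑ * G ((contour t s).re + (contour t s).im) with hF
  have hcover : (∫⁻ s, F s) ≤ (∫⁻ s in Set.Iio 0, F s) + (∫⁻ s in Set.Ioi (m : ℝ), F s) +
      ∑ i : Fin m, ∫⁻ s in Set.Ioo ((i : ℕ) : ℝ) ((i : ℕ) + 1), F s := by
    have hae : ∀ᵐ s : ℝ, s ∈ (Set.Iio 0 ∪ Set.Ioi (m : ℝ)) ∪
        ⋃ i : Fin m, Set.Ioo ((i : ℕ) : ℝ) ((i : ℕ) + 1) := by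
      have hc : (Set.range (Nat.cast : ℕ → ℝ)).Countable := Set.countable_range _
      filter_upwards [hc.ae_notMem volume] with s hs
      by_cases h0 : s < 0
      · exact Or.inl (Or.inl h0)
      by_cases h1 : (m : ℝ) < s
      · exact Or.inl (Or.inr h1)
      push Not at h0 h1
      have hfl := Nat.floor_le h0
      have hlt := Nat.lt_floor_add_one s
      have hne : (⌊s⌋₊ : ℝ) ≠ s := fun h => hs ⟨_, h⟩
      have hne' : (m : ℝ) ≠ s := fun h => hs ⟨_, h⟩
      have hm : ⌊s⌋₊ < m := by
        rw [Nat.floor_lt h0]; exact lt_of_le_of_ne h1 hne'.symm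
      exact Or.inr (Set.mem_iUnion.2 ⟨⟨_, hm⟩, lt_of_le_of_ne hfl hne, hlt⟩)
    calc ∫⁻ s, F s = ∫⁻ s in (Set.Iio 0 ∪ Set.Ioi (m : ℝ)) ∪
        ⋃ i : Fin m, Set.Ioo ((i : ℕ) : ℝ) ((i : ℕ) + 1), F s := by
          rw [Measure.restrict_eq_self_of_ae_mem hae]
      _ ≤ _ := by
          refine (lintegral_union_le _ _ _).trans (add_le_add (lintegral_union_le _ _ _) ?_)
          refine (lintegral_iUnion_le _ _).trans ?_
          rw [tsum_fintype]
  refine hcover.trans ?_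
  have h1 : ∫⁻ s in Set.Iio 0, F s ≤ ∫⁻ x, G x :=
    lintegral_contour_piece_le isOpen_Iio _ _ 1 (by simp) (by simp)
      (fun s hs => contour_eq_of_neg t hs) hG
  have h2 : ∫⁻ s in Set.Ioi (m : ℝ), F s ≤ ∫⁻ x, G x :=
    lintegral_contour_piece_le isOpen_Ioi _ _ 1 (by simp) (by simp)
      (fun s hs => contour_eq_of_gt t hs) hG
  have h3 : ∀ i : Fin m, ∫⁻ s in Set.Ioo ((i : ℕ) : ℝ) ((i : ℕ) + 1), F s ≤ ∫⁻ x, G x :=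
    fun i => lintegral_contour_piece_le isOpen_Ioo _ _ (t i.succ - t i.castSucc)
      (by rw [norm_mul, Complex.norm_real]; simp) (by rw [Complex.I_mul_re, Complex.I_mul_im]; simp)
      (fun s hs => contour_eq_of_mem t i hs) hG
  refine (add_le_add (add_le_add h1 h2) (Finset.sum_le_sum fun i _ => h3 i)).trans ?_
  simp only [Finset.sum_const, Finset.card_univ, Fintype.card_fin, nsmul_eq_mul]
  apply le_of_eq
  ring

/-- A one-variable bound on a weighted push-forward tensorizes: peel off one coordinate with Tonelli
and apply the bound to the partial integral. -/
theorem lintegral_pi_push_le {X Y : Type*} [MeasureSpace X] [MeasureSpace Y]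
    [SigmaFinite (volume : Measure X)] [SigmaFinite (volume : Measure Y)]
    {k : X → ENNReal} (hk : Measurable k) {ψ : X → Y} (hψ : Measurable ψ) {C : ENNReal}
    (h : ∀ G : Y → ENNReal, Measurable G → ∫⁻ x, k x * G (ψ x) ≤ C * ∫⁻ y, G y) (w : ℕ) :
    ∀ H : (Fin w → Y) → ENNReal, Measurable H →
      ∫⁻ z : Fin w → X, (∏ l, k (z l)) * H (fun l => ψ (z l)) ≤ C ^ w * ∫⁻ y, H y := by
  induction w with
  | zero => intro H hH; simp [volume_pi, lintegral_unique, Subsingleton.elim _ (default : Fin 0 → Y)]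
  | succ w ih =>
    intro H hH
    have eX := (volume_preserving_piFinSuccAbove (fun _ : Fin (w + 1) => X) 0).symm
    have eY := (volume_preserving_piFinSuccAbove (fun _ : Fin (w + 1) => Y) 0).symm
    have hH' : Measurable fun a : Y × (Fin w → Y) =>
        H ((MeasurableEquiv.piFinSuccAbove (fun _ : Fin (w + 1) => Y) 0).symm a) :=
      hH.comp (MeasurableEquiv.measurable _)
    rw [← eX.lintegral_comp_emb (MeasurableEquiv.measurableEmbedding _),
      ← eY.lintegral_comp_emb (MeasurableEquiv.measurableEmbedding _)]
    have hrw : ∀ a : X × (Fin w → X),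
        (∏ l, k ((MeasurableEquiv.piFinSuccAbove (fun _ : Fin (w + 1) => X) 0).symm a l)) *
          H (fun l => ψ ((MeasurableEquiv.piFinSuccAbove (fun _ : Fin (w + 1) => X) 0).symm a l)) =
        k a.1 * ((∏ l, k (a.2 l)) *
          H ((MeasurableEquiv.piFinSuccAbove (fun _ : Fin (w + 1) => Y) 0).symm
            (ψ a.1, fun l => ψ (a.2 l)))) := by
      intro a
      rw [Fin.prod_univ_succ, mul_assoc]
      congr 2
      congr 1
      funext l
      refine Fin.cases ?_ (fun i => ?_) l <;> simp [MeasurableEquiv.piFinSuccAbove, Fin.insertNthEquiv]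
    simp_rw [hrw]
    have hmeas : Measurable fun a : X × (Fin w → X) => k a.1 * ((∏ l, k (a.2 l)) *
          H ((MeasurableEquiv.piFinSuccAbove (fun _ : Fin (w + 1) => Y) 0).symm
            (ψ a.1, fun l => ψ (a.2 l)))) := by
      refine (hk.comp measurable_fst).mul ((Finset.measurable_fun_prod _ fun l _ => by fun_prop).mul ?_)
      exact hH'.comp (by fun_prop)
    rw [Measure.volume_eq_prod, lintegral_prod _ hmeas.aemeasurable, Measure.volume_eq_prod,
      lintegral_prod _ hH'.aemeasurable]
    have hin : ∀ x : X, ∫⁻ y : Fin w → X, k x * ((∏ l, k (y l)) *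
          H ((MeasurableEquiv.piFinSuccAbove (fun _ : Fin (w + 1) => Y) 0).symm
            (ψ x, fun l => ψ (y l)))) ≤ k x * (C ^ w * ∫⁻ y : Fin w → Y,
            H ((MeasurableEquiv.piFinSuccAbove (fun _ : Fin (w + 1) => Y) 0).symm (ψ x, y))) := by
      intro x
      rw [lintegral_const_mul]
      · gcongr
        exact ih (fun y => H ((MeasurableEquiv.piFinSuccAbove (fun _ : Fin (w + 1) => Y) 0).symm
          (ψ x, y))) (hH'.comp (by fun_prop))
      · refine (Finset.measurable_fun_prod _ fun l _ => by fun_prop).mul ?_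
        exact hH'.comp (f := fun y : Fin w → X => (ψ x, fun l => ψ (y l))) (by fun_prop)
    refine (lintegral_mono hin).trans ?_
    have hG : Measurable fun y0 : Y => C ^ w * ∫⁻ y : Fin w → Y,
        H ((MeasurableEquiv.piFinSuccAbove (fun _ : Fin (w + 1) => Y) 0).symm (y0, y)) :=
      (Measurable.lintegral_prod_right' hH').const_mul _
    refine (h _ hG).trans ?_
    rw [lintegral_const_mul _ (Measurable.lintegral_prod_right' hH'), pow_succ']
    apply le_of_eq
    ring

theorem continuous_contour_uncurry {m : ℕ} :
    Continuous (Function.uncurry (contour : (Fin (m + 1) → ℝ) → ℝ → ℂ)) := by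
  unfold Function.uncurry contour
  fun_prop

theorem continuous_contour {m : ℕ} (t : Fin (m + 1) → ℝ) : Continuous (contour t) := by
  unfold contour
  fun_prop

theorem measurable_deriv_contour {m : ℕ} (t : Fin (m + 1) → ℝ) :
    Measurable (deriv (contour t)) := measurable_deriv _

theorem lintegral_tube_le {m w : ℕ} (u : Fin (m + 1) → Cylinder)
    {H : (Fin w → Cylinder) → ENNReal} (hH : Measurable H) :
    ∫⁻ z : Fin w → ℝ × AddCircle (2 : ℝ),
      (∏ l, ‖deriv (contour (fun j => (u j).1)) (z l).1‖ₑ) *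
        H (fun l => rotate (tubePoint u (z l))) ≤
      (m + 2) ^ w * ∫⁻ y, H y := by
  set t : Fin (m + 1) → ℝ := fun j => (u j).1
  have hc := continuous_contour t
  have hd := measurable_deriv_contour t
  refine lintegral_pi_push_le (k := fun z : ℝ × AddCircle (2 : ℝ) => ‖deriv (contour t) z.1‖ₑ)
    (ψ := fun z : ℝ × AddCircle (2 : ℝ) => rotate (tubePoint u z)) (by fun_prop) ?_ ?_ w H hH
  · unfold rotate tubePoint
    fun_prop
  · intro G hG
    have hψ : Measurable fun z : ℝ × AddCircle (2 : ℝ) => rotate (tubePoint u z) := by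
      unfold rotate tubePoint
      fun_prop
    rw [Measure.volume_eq_prod, lintegral_prod_symm _ (by fun_prop), lintegral_prod_symm _ (by fun_prop),
      ← lintegral_const_mul _ hG.lintegral_prod_left']
    refine lintegral_mono fun y => ?_
    exact lintegral_contour_le t (G := fun s => G (s, y)) (by fun_prop)

/-! ### Iterated integrals over finite products -/

section Marginal

variable {ι X : Type*} [DecidableEq ι] [MeasureSpace X]
  [SigmaFinite (volume : Measure X)]

/-- The new factor does not see the variables already integrated out, so it leaves the inner
integral, which is bounded uniformly before the new point is integrated. -/
theorem lmarginal_prod_insert_le {h : ι → (ι → X) → ENNReal} (hm : ∀ i, Measurable (h i))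
    {K : ENNReal} {s : Finset ι} {i : ι} (hi : i ∉ s)
    (hind : ∀ x y : ι → X, (∀ j ∉ s, x j = y j) → h i x = h i y)
    (hK : ∀ x, ∫⁻ y, h i (Function.update x i y) ≤ K)
    (hs : ∀ x, lmarginal (fun _ => volume) s (fun x => ∏ j ∈ s, h j x) x ≤ K ^ s.card)
    (x : ι → X) :
    lmarginal (fun _ => volume) (insert i s) (fun x => ∏ j ∈ insert i s, h j x) x ≤
      K ^ (insert i s).card := by
  have hmeas : ∀ s : Finset ι, Measurable fun x => ∏ j ∈ s, h j x := fun s =>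
    Finset.measurable_fun_prod _ fun j _ => hm j
  rw [lmarginal_insert _ (hmeas _) hi, Finset.card_insert_of_notMem hi, pow_succ']
  have hpt : ∀ x : ι → X, lmarginal (fun _ => volume) s (fun x => ∏ j ∈ insert i s, h j x) x =
      h i x * lmarginal (fun _ => volume) s (fun x => ∏ j ∈ s, h j x) x := by
    intro x
    simp only [Finset.prod_insert hi, lmarginal]
    have hms : Measurable fun y : (∀ _ : s, X) => ∏ j ∈ s, h j (Function.updateFinset x s y) :=
      (hmeas s).comp measurable_updateFinset
    rw [← lintegral_const_mul _ hms]
    refine lintegral_congr fun y => ?_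
    congr 1
    apply hind
    intro j hj
    simp [Function.updateFinset, hj]
  simp_rw [hpt]
  calc ∫⁻ y, h i (Function.update x i y) *
        lmarginal (fun _ => volume) s (fun x => ∏ j ∈ s, h j x) (Function.update x i y)
      ≤ ∫⁻ y, h i (Function.update x i y) * K ^ s.card := by
        gcongr with y; exact hs _
    _ = (∫⁻ y, h i (Function.update x i y)) * K ^ s.card := by
        have hmi : Measurable fun y => h i (Function.update x i y) :=
          (hm i).comp (measurable_update x)
        rw [lintegral_mul_const _ hmi]
    _ ≤ K * K ^ s.card := by gcongr; exact hK x

variable [Fintype ι]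

/-- A product over the points of two classes, in which the factors of the first class depend on
their own point and the points of the second class, and those of the second class only on their own
point, is integrated one point at a time. -/
theorem lintegral_prod_le_of_classes (A : ι → Prop) [DecidablePred A]
    {h : ι → (ι → X) → ENNReal} (hm : ∀ i, Measurable (h i)) {K : ENNReal}
    (hA : ∀ i, A i → ∀ x y : ι → X, x i = y i → (∀ j, ¬ A j → x j = y j) → h i x = h i y)
    (hA' : ∀ i, ¬ A i → ∀ x y : ι → X, x i = y i → h i x = h i y)
    (hK : ∀ i x, ∫⁻ y, h i (Function.update x i y) ≤ K) :
    ∫⁻ x : ι → X, ∏ i, h i x ≤ K ^ Fintype.card ι := by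
  -- The dependent class is integrated first, while the points its factors refer to are still
  -- frozen.
  have h1 : ∀ s : Finset ι, (∀ i ∈ s, A i) →
      ∀ x, lmarginal (fun _ => volume) s (fun x => ∏ j ∈ s, h j x) x ≤ K ^ s.card := by
    intro s
    induction s using Finset.induction_on with
    | empty => intro _ x; simp
    | insert i s hi ih =>
      intro hs
      refine lmarginal_prod_insert_le hm hi ?_ (hK i)
        (ih fun j hj => hs j (Finset.mem_insert_of_mem hj))
      intro x y hxy
      exact hA i (hs i (Finset.mem_insert_self _ _)) x y (hxy i hi) fun j hj =>
        hxy j fun hjs => hj (hs j (Finset.mem_insert_of_mem hjs))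
  have h2 : ∀ s : Finset ι, (∀ i ∈ s, ¬ A i) →
      ∀ x, lmarginal (fun _ => volume) (s ∪ Finset.univ.filter A)
        (fun x => ∏ j ∈ s ∪ Finset.univ.filter A, h j x) x ≤
        K ^ (s ∪ Finset.univ.filter A).card := by
    intro s
    induction s using Finset.induction_on with
    | empty =>
      intro _
      rw [Finset.empty_union]
      exact h1 _ (by simp)
    | insert i s hi ih =>
      intro hs
      rw [Finset.insert_union]
      have hni : ¬ A i := hs i (Finset.mem_insert_self _ _)
      have hi' : i ∉ s ∪ Finset.univ.filter A := by simp [hi, hni]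
      refine lmarginal_prod_insert_le hm hi' ?_ (hK i)
        (ih fun j hj => hs j (Finset.mem_insert_of_mem hj))
      intro x y hxy
      exact hA' i hni x y (hxy i hi')
  rcases isEmpty_or_nonempty (ι → X) with hE | ⟨⟨x⟩⟩
  · rw [lintegral_of_isEmpty]; exact zero_le
  · have hU : Finset.univ.filter (fun i => ¬ A i) ∪ Finset.univ.filter A = Finset.univ := by
      ext i; simp [em']
    have := h2 (Finset.univ.filter fun i => ¬ A i) (by simp) x
    rw [hU] at this
    rw [volume_pi, lintegral_eq_lmarginal_univ x]
    exact this

/-- A measurable subset of a product is null if its sections in one coordinate are. -/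
theorem ae_pi_of_forall_update (i : ι) {B : (ι → X) → Prop} (hB : MeasurableSet {x | B x})
    (h : ∀ x, ∀ᵐ y, B (Function.update x i y)) : ∀ᵐ x : ι → X, B x := by
  rw [ae_iff]
  have hBc : MeasurableSet {x | ¬ B x} := hB.compl
  rw [← lintegral_indicator_one hBc, volume_pi]
  have := lintegral_eq_of_lmarginal_eq (μ := fun _ : ι => (volume : Measure X)) {i}
    (f := Set.indicator {x | ¬ B x} 1) (g := fun _ => 0)
    (measurable_one.indicator hBc) measurable_const ?_
  · rw [this]; simp
  · rw [lmarginal_singleton, lmarginal_singleton]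
    funext x
    have hmi : Measurable fun y => Set.indicator {x | ¬ B x} (1 : (ι → X) → ENNReal)
        (Function.update x i y) :=
      (measurable_one.indicator hBc).comp (measurable_update x)
    rw [lintegral_zero, lintegral_eq_zero_iff hmi]
    filter_upwards [h x] with y hy
    simp [hy]

end Marginal

/-! ### Integrals over the cylinder in light-cone coordinates -/

theorem abs_le_chord {x : ℝ} (hx : |x| ≤ 1) : |x| ≤ chord (x : AddCircle (2 : ℝ)) := by
  have h1 : chord (x : AddCircle (2 : ℝ)) = ‖2 * Real.sin (Real.pi * x / 2)‖ := by
    rw [← Complex.norm_exp_I_mul_ofReal_sub_one, chord, circleChar_coe, norm_sub_rev]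
    congr 3; push_cast; ring
  have hpi := Real.pi_pos
  have h2 : |Real.pi * x / 2| = Real.pi * |x| / 2 := by
    rw [abs_div, abs_mul, abs_of_pos hpi, abs_two]
  have h3 := Real.mul_abs_le_abs_sin (x := Real.pi * x / 2) (by rw [h2]; nlinarith)
  rw [h2] at h3
  have h4 : 2 / Real.pi * (Real.pi * |x| / 2) = |x| := by field_simp
  rw [h4] at h3
  rw [h1, norm_mul, Real.norm_eq_abs, Real.norm_eq_abs, abs_two]
  linarith [abs_nonneg x]

theorem lintegral_chord_rpow_lt_top {γ : ℝ} (h0 : 0 < γ) (h1 : γ < 1) :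
    ∫⁻ θ : AddCircle (2 : ℝ), ENNReal.ofReal ((chord θ)⁻¹ ^ γ) < ⊤ := by
  rw [← AddCircle.lintegral_preimage 2 (-1)]
  have hb : ∀ a ∈ Set.Ioc (-1 : ℝ) (-1 + 2),
      ENNReal.ofReal ((chord (a : AddCircle (2 : ℝ)))⁻¹ ^ γ) ≤
        Set.indicator (Set.Ioc 0 1) (fun x => ENNReal.ofReal (x ^ (-γ))) a +
        Set.indicator (Set.Ioc 0 1) (fun x => ENNReal.ofReal (x ^ (-γ))) (-a) := by
    intro a ha
    rcases lt_trichotomy a 0 with h | h | h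
    · have hm : -a ∈ Set.Ioc (0 : ℝ) 1 := ⟨by linarith, by linarith [ha.1]⟩
      rw [Set.indicator_of_mem hm]
      refine le_trans (ENNReal.ofReal_le_ofReal ?_) le_add_self
      have h2 := abs_le_chord (x := a) (by rw [abs_of_neg h]; exact hm.2)
      rw [abs_of_neg h] at h2
      rw [Real.rpow_neg hm.1.le, ← Real.inv_rpow hm.1.le]
      exact Real.rpow_le_rpow (inv_nonneg.2 (chord_nonneg _)) (inv_anti₀ hm.1 h2) h0.le
    · subst h
      have : chord ((0 : ℝ) : AddCircle (2 : ℝ)) = 0 := chord_eq_zero.2 rfl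
      rw [this, inv_zero, Real.zero_rpow h0.ne']
      simp
    · have hm : a ∈ Set.Ioc (0 : ℝ) 1 := ⟨h, by linarith [ha.2]⟩
      rw [Set.indicator_of_mem hm]
      refine le_trans (ENNReal.ofReal_le_ofReal ?_) le_self_add
      have h2 := abs_le_chord (x := a) (by rw [abs_of_pos h]; exact hm.2)
      rw [abs_of_pos h] at h2
      rw [Real.rpow_neg hm.1.le, ← Real.inv_rpow hm.1.le]
      exact Real.rpow_le_rpow (inv_nonneg.2 (chord_nonneg _)) (inv_anti₀ hm.1 h2) h0.le
  have hfin : ∫⁻ x : ℝ, Set.indicator (Set.Ioc 0 1) (fun x => ENNReal.ofReal (x ^ (-γ))) x < ⊤ := by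
    rw [lintegral_indicator measurableSet_Ioc]
    have := intervalIntegral.intervalIntegrable_rpow' (a := 0) (b := 1) (r := -γ) (by linarith)
    rw [intervalIntegrable_iff_integrableOn_Ioc_of_le zero_le_one] at this
    exact this.lintegral_lt_top
  have hmeas : Measurable (Set.indicator (Set.Ioc (0 : ℝ) 1) (fun x => ENNReal.ofReal (x ^ (-γ)))) :=
    Measurable.indicator (by fun_prop) measurableSet_Ioc
  refine (setLIntegral_mono' measurableSet_Ioc hb).trans_lt ?_
  refine (setLIntegral_le_lintegral _ _).trans_lt ?_
  rw [lintegral_add_left hmeas, lintegral_neg_eq_self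
    (Set.indicator (Set.Ioc (0 : ℝ) 1) (fun x => ENNReal.ofReal (x ^ (-γ))))]
  exact ENNReal.add_lt_top.2 ⟨hfin, hfin⟩

/-- The map (a, x) ↦ (a + x, a - x) is two-to-one on the torus yet preserves measure: after a
translation it reduces to doubling x, which preserves Haar measure on the circle. -/
theorem lintegral_circle_shear {f g : AddCircle (2 : ℝ) → ENNReal} (hf : Measurable f)
    (hg : Measurable g) :
    ∫⁻ a : AddCircle (2 : ℝ), ∫⁻ x : AddCircle (2 : ℝ), f (a + x) * g (a - x) =
      (∫⁻ a, f a) * ∫⁻ a, g a := by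
  rw [lintegral_lintegral_swap (by fun_prop)]
  have h1 : ∀ x : AddCircle (2 : ℝ), ∫⁻ a : AddCircle (2 : ℝ), f (a + x) * g (a - x) =
      ∫⁻ a : AddCircle (2 : ℝ), f a * g (a - 2 • x) := by
    intro x
    rw [← lintegral_add_right_eq_self (fun a => f a * g (a - 2 • x)) x]
    refine lintegral_congr fun a => ?_
    congr 2
    rw [two_nsmul]; abel
  simp_rw [h1]
  rw [lintegral_lintegral_swap (by fun_prop), ← lintegral_mul_const _ hf]
  refine lintegral_congr fun a => ?_
  rw [lintegral_const_mul _ (by fun_prop)]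
  congr 1
  have h2 := (AddCircle.ergodic_nsmul (T := 2) (n := 2) one_lt_two).toMeasurePreserving
  have h3 : Measurable fun y : AddCircle (2 : ℝ) => g (a - y) := by fun_prop
  rw [h2.lintegral_comp h3]
  exact lintegral_sub_left_eq_self g a

theorem tsum_exp_neg_int_lt_top {c : ℝ} (hc : 0 < c) :
    ∑' n : ℤ, ENNReal.ofReal (Real.exp (-(c * |(n : ℝ)|))) < ⊤ := by
  have hnat : Summable fun n : ℕ => Real.exp (-(c * n)) := by
    have := summable_geometric_of_lt_one (Real.exp_pos (-c)).le (Real.exp_lt_one_iff.2 (by linarith))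
    refine this.congr fun n => ?_
    rw [← Real.exp_nat_mul]; congr 1; ring
  have hs : Summable fun n : ℤ => Real.exp (-(c * |(n : ℝ)|)) := by
    rw [summable_int_iff_summable_nat_and_neg]
    constructor <;> simpa using hnat
  rw [← ENNReal.ofReal_tsum_of_nonneg (fun n => (Real.exp_pos _).le) hs]
  exact ENNReal.ofReal_lt_top

/-- The exponential weight in the time variable. -/
def timeWeight (c : ℝ) (t : ℝ) : ENNReal := ENNReal.ofReal (Real.exp (-(c * |t|)))

theorem measurable_timeWeight (c : ℝ) : Measurable (timeWeight c) := by
  unfold timeWeight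
  fun_prop

/-- On the n-th period |t| ≥ 2|n| - 2, so the weight is at most e^{2c} e^{-2c|n|}, which is summable
over the periods. -/
theorem lintegral_timeWeight_periodic_le {c : ℝ} (hc : 0 < c) :
    ∃ C : ENNReal, C < ⊤ ∧ ∀ J : AddCircle (2 : ℝ) → ENNReal, Measurable J →
      ∫⁻ t : ℝ, timeWeight c t * J t ≤ C * ∫⁻ a, J a := by
  refine ⟨(∑' n : ℤ, ENNReal.ofReal (Real.exp (-((2 * c) * |(n : ℝ)|)))) *
    ENNReal.ofReal (Real.exp (2 * c)),
    ENNReal.mul_lt_top (tsum_exp_neg_int_lt_top (by linarith)) ENNReal.ofReal_lt_top, ?_⟩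
  intro J hJ
  have hU := iUnion_Ioc_add_zsmul (two_pos : (0 : ℝ) < 2) 0
  calc ∫⁻ t : ℝ, timeWeight c t * J t
      = ∫⁻ t in ⋃ n : ℤ, Set.Ioc ((0 : ℝ) + n • (2 : ℝ)) (0 + (n + 1) • (2 : ℝ)),
          timeWeight c t * J t := by rw [hU, setLIntegral_univ]
    _ ≤ ∑' n : ℤ, ∫⁻ t in Set.Ioc ((0 : ℝ) + n • (2 : ℝ)) (0 + (n + 1) • (2 : ℝ)),
          timeWeight c t * J t := lintegral_iUnion_le _ _
    _ ≤ ∑' n : ℤ, ENNReal.ofReal (Real.exp (-((2 * c) * |(n : ℝ)|))) *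
          (ENNReal.ofReal (Real.exp (2 * c)) * ∫⁻ a, J a) := by
        refine ENNReal.tsum_le_tsum fun n => ?_
        have hJm : Measurable fun t : ℝ => J t := hJ.comp AddCircle.measurable_mk'
        have hI : ∫⁻ t in Set.Ioc ((0 : ℝ) + n • (2 : ℝ)) (0 + (n + 1) • (2 : ℝ)), J t =
            ∫⁻ a, J a := by
          rw [← AddCircle.lintegral_preimage 2 ((0 : ℝ) + n • (2 : ℝ)), add_smul, one_smul,
            add_assoc]
        rw [← mul_assoc, ← ENNReal.ofReal_mul (Real.exp_pos _).le, ← Real.exp_add, ← hI,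
          ← lintegral_const_mul _ hJm]
        refine setLIntegral_mono' measurableSet_Ioc fun t ht => ?_
        unfold timeWeight
        gcongr
        simp only [zsmul_eq_mul, zero_add, Int.cast_add, Int.cast_one, Set.mem_Ioc] at ht
        have h1 : 2 * |(n : ℝ)| ≤ |t| + 2 := by
          rcases abs_cases (n : ℝ) with ⟨h, _⟩ | ⟨h, _⟩ <;> rcases abs_cases t with ⟨h', _⟩ | ⟨h', _⟩ <;>
            rw [h, h'] <;> linarith [ht.1, ht.2]
        nlinarith
    _ = _ := by rw [ENNReal.tsum_mul_right, mul_assoc]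

theorem lintegral_cylinder_lightCone_le {c : ℝ} (hc : 0 < c) :
    ∃ C : ENNReal, C < ⊤ ∧ ∀ f g : AddCircle (2 : ℝ) → ENNReal, Measurable f → Measurable g →
      ∫⁻ y : Cylinder, timeWeight c y.1 * (f (cylAdd y) * g (cylSub y)) ≤
        C * ((∫⁻ a, f a) * ∫⁻ a, g a) := by
  obtain ⟨C, hC, h⟩ := lintegral_timeWeight_periodic_le hc
  refine ⟨C, hC, fun f g hf hg => ?_⟩
  have hρ := measurable_timeWeight c
  have hmk : Measurable fun t : ℝ => (t : AddCircle (2 : ℝ)) := AddCircle.measurable_mk'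
  have hm : Measurable fun y : Cylinder => timeWeight c y.1 * (f (cylAdd y) * g (cylSub y)) := by
    unfold cylAdd cylSub
    fun_prop
  rw [Measure.volume_eq_prod, lintegral_prod _ hm.aemeasurable, ← lintegral_circle_shear hf hg]
  refine le_trans (le_of_eq ?_) (h _ (Measurable.lintegral_prod_right'
    (f := fun p : AddCircle (2 : ℝ) × AddCircle (2 : ℝ) => f (p.1 + p.2) * g (p.1 - p.2))
    (by fun_prop)))
  refine lintegral_congr fun t => ?_
  rw [← lintegral_const_mul _ (by fun_prop)]
  rfl

/-! ### The dominating function -/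

theorem measurable_chord : Measurable chord := continuous_chord.measurable

/-- Powers with exponent below 1 are subadditive, so several poles never multiply: each summand has
a single singularity. -/
theorem ofReal_one_add_sum_rpow_le {ι : Type*} {γ : ℝ} (h0 : 0 < γ) (h1 : γ < 1) (s : Finset ι) (r : ι → ℝ)
    (hr : ∀ i, 0 ≤ r i) :
    ENNReal.ofReal ((1 + ∑ i ∈ s, r i) ^ γ) ≤ 1 + ∑ i ∈ s, ENNReal.ofReal (r i ^ γ) := by
  classical
  have : (1 + ∑ i ∈ s, r i) ^ γ ≤ 1 + ∑ i ∈ s, r i ^ γ := by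
    induction s using Finset.induction_on with
    | empty => simp
    | insert i s hi ih =>
      rw [Finset.sum_insert hi, Finset.sum_insert hi, add_left_comm, add_left_comm (1 : ℝ)]
      refine (Real.rpow_add_le_add_rpow (hr i)
        (add_nonneg zero_le_one (Finset.sum_nonneg fun j _ => hr j)) h0.le h1.le).trans ?_
      linarith
  refine (ENNReal.ofReal_le_ofReal this).trans ?_
  rw [ENNReal.ofReal_add zero_le_one (Finset.sum_nonneg fun j _ => Real.rpow_nonneg (hr j) _),
    ENNReal.ofReal_one, ENNReal.ofReal_sum_of_nonneg fun j _ => Real.rpow_nonneg (hr j) _]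

/-- Bound for a power of the inverse smearing scale as a function of one light-cone coordinate. -/
def scaleBound {ι : Type*} (γ : ℝ) (s : Finset ι) (y : ι → AddCircle (2 : ℝ)) (θ : AddCircle (2 : ℝ)) :
    ENNReal :=
  1 + ∑ q ∈ s, ENNReal.ofReal ((5 * (chord (θ - y q))⁻¹) ^ γ)

theorem measurable_scaleBound {ι : Type*} (γ : ℝ) (s : Finset ι) (y : ι → AddCircle (2 : ℝ)) :
    Measurable (scaleBound γ s y) := by
  have := measurable_chord
  unfold scaleBound
  fun_prop

section Dominating

variable {ι : Type*} [Fintype ι]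

/-- Inverse smearing scale of the `i`-th point in the light-cone coordinate `κ`: it dominates the
inverse distances to the points of the other class. -/
def invScale (κ : Cylinder → AddCircle (2 : ℝ)) (A : ι → Bool) (x : ι → Cylinder) (i : ι) : ℝ :=
  1 + ∑ q ∈ Finset.univ.filter (fun q => A q ≠ A i), 5 * (chord (κ (x i) - κ (x q)))⁻¹

theorem one_le_invScale (κ : Cylinder → AddCircle (2 : ℝ)) (A : ι → Bool) (x : ι → Cylinder)
    (i : ι) : 1 ≤ invScale κ A x i := by
  unfold invScale
  have : 0 ≤ ∑ q ∈ Finset.univ.filter (fun q => A q ≠ A i),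
      5 * (chord (κ (x i) - κ (x q)))⁻¹ :=
    Finset.sum_nonneg fun q _ => mul_nonneg (by norm_num) (inv_nonneg.2 (chord_nonneg _))
  linarith

theorem le_invScale (κ : Cylinder → AddCircle (2 : ℝ)) (A : ι → Bool) (x : ι → Cylinder)
    {i q : ι} (h : A q ≠ A i) : 5 * (chord (κ (x i) - κ (x q)))⁻¹ ≤ invScale κ A x i := by
  unfold invScale
  have := Finset.single_le_sum (f := fun q => 5 * (chord (κ (x i) - κ (x q)))⁻¹)
    (s := Finset.univ.filter (fun q => A q ≠ A i))
    (fun q _ => mul_nonneg (by norm_num) (inv_nonneg.2 (chord_nonneg _)))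
    (Finset.mem_filter.2 ⟨Finset.mem_univ q, h⟩)
  linarith

theorem measurable_cylAdd : Measurable cylAdd := by
  have hmk : Measurable fun t : ℝ => (t : AddCircle (2 : ℝ)) := AddCircle.measurable_mk'
  unfold cylAdd; fun_prop

theorem measurable_cylSub : Measurable cylSub := by
  have hmk : Measurable fun t : ℝ => (t : AddCircle (2 : ℝ)) := AddCircle.measurable_mk'
  unfold cylSub; fun_prop

theorem measurable_invScale {κ : Cylinder → AddCircle (2 : ℝ)} (hκ : Measurable κ) (A : ι → Bool)
    (i : ι) : Measurable fun x => invScale κ A x i := by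
  have := measurable_chord
  unfold invScale
  fun_prop

theorem lintegral_scaleBound_le (γ : ℝ) (s : Finset ι)
    (y : ι → AddCircle (2 : ℝ)) :
    ∫⁻ θ, scaleBound γ s y θ ≤ 2 + Fintype.card ι * (ENNReal.ofReal (5 ^ γ) *
      ∫⁻ θ : AddCircle (2 : ℝ), ENNReal.ofReal ((chord θ)⁻¹ ^ γ)) := by
  have hc := measurable_chord
  unfold scaleBound
  rw [lintegral_add_left measurable_const, lintegral_finsetSum _ (fun q _ => by fun_prop)]
  have hq : ∀ q, ∫⁻ θ : AddCircle (2 : ℝ), ENNReal.ofReal ((5 * (chord (θ - y q))⁻¹) ^ γ) =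
      ENNReal.ofReal (5 ^ γ) * ∫⁻ θ : AddCircle (2 : ℝ), ENNReal.ofReal ((chord θ)⁻¹ ^ γ) := by
    intro q
    rw [← lintegral_sub_right_eq_self
      (fun θ : AddCircle (2 : ℝ) => ENNReal.ofReal ((chord θ)⁻¹ ^ γ)) (y q),
      ← lintegral_const_mul _ (by fun_prop)]
    refine lintegral_congr fun θ => ?_
    rw [Real.mul_rpow (by norm_num) (inv_nonneg.2 (chord_nonneg _)), ENNReal.ofReal_mul (by positivity)]
  gcongr
  · rw [lintegral_one, AddCircle.measure_univ]; simp
  · simp_rw [hq]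
    rw [Finset.sum_const, nsmul_eq_mul]
    gcongr
    exact_mod_cast Finset.card_le_univ s

/-- Both light-cone inverse scales of the `i`-th point. -/
def scaleProd (A : ι → Bool) (x : ι → Cylinder) (i : ι) : ℝ :=
  invScale cylAdd A x i * invScale cylSub A x i

theorem one_le_scaleProd (A : ι → Bool) (x : ι → Cylinder) (i : ι) : 1 ≤ scaleProd A x i :=
  one_le_mul_of_one_le_of_one_le (one_le_invScale _ _ _ _) (one_le_invScale _ _ _ _)

theorem measurable_scaleProd (A : ι → Bool) (i : ι) :
    Measurable fun x : ι → Cylinder => scaleProd A x i :=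
  (measurable_invScale measurable_cylAdd A i).mul (measurable_invScale measurable_cylSub A i)

theorem scaleProd_congr (A : ι → Bool) (i : ι) {x y : ι → Cylinder} (hi : x i = y i)
    (h : ∀ q, A q ≠ A i → x q = y q) : scaleProd A x i = scaleProd A y i := by
  unfold scaleProd invScale
  rw [hi]
  congr 2 <;>
  · refine Finset.sum_congr rfl fun q hq => ?_
    rw [h q (Finset.mem_filter.1 hq).2]

theorem ofReal_scaleProd_rpow_le [DecidableEq ι] {γ : ℝ} (h0 : 0 < γ) (h1 : γ < 1) (A : ι → Bool)
    (x : ι → Cylinder) (i : ι) (y : Cylinder) :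
    ENNReal.ofReal (scaleProd A (Function.update x i y) i ^ γ) ≤
      scaleBound γ (Finset.univ.filter fun q => A q ≠ A i) (fun q => cylAdd (x q)) (cylAdd y) *
      scaleBound γ (Finset.univ.filter fun q => A q ≠ A i) (fun q => cylSub (x q)) (cylSub y) := by
  have hpos : ∀ κ : Cylinder → AddCircle (2 : ℝ), 0 ≤ invScale κ A (Function.update x i y) i :=
    fun κ => zero_le_one.trans (one_le_invScale _ _ _ _)
  have hle : ∀ κ : Cylinder → AddCircle (2 : ℝ),
      ENNReal.ofReal (invScale κ A (Function.update x i y) i ^ γ) ≤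
      scaleBound γ (Finset.univ.filter fun q => A q ≠ A i) (fun q => κ (x q)) (κ y) := by
    intro κ
    have : invScale κ A (Function.update x i y) i =
        1 + ∑ q ∈ Finset.univ.filter (fun q => A q ≠ A i), 5 * (chord (κ y - κ (x q)))⁻¹ := by
      unfold invScale
      congr 1
      refine Finset.sum_congr rfl fun q hq => ?_
      have hne : q ≠ i := fun h => (Finset.mem_filter.1 hq).2 (by rw [h])
      rw [Function.update_self, Function.update_of_ne hne]
    rw [this]
    exact ofReal_one_add_sum_rpow_le h0 h1 _ _
      fun q => mul_nonneg (by norm_num) (inv_nonneg.2 (chord_nonneg _))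
  unfold scaleProd
  rw [Real.mul_rpow (hpos _) (hpos _), ENNReal.ofReal_mul (Real.rpow_nonneg (hpos _) _)]
  exact mul_le_mul' (hle cylAdd) (hle cylSub)

theorem lintegral_weighted_scaleProd_lt_top {γ c : ℝ} (h0 : 0 < γ) (h1 : γ < 1) (hc : 0 < c)
    (A : ι → Bool) (β : Bool) :
    ∫⁻ x : ι → Cylinder, ∏ i, (timeWeight c (x i).1 *
      if A i = β then ENNReal.ofReal (scaleProd A x i ^ γ) else 1) < ⊤ := by
  classical
  obtain ⟨C, hC, hcyl⟩ := lintegral_cylinder_lightCone_le hc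
  set L : ENNReal := 2 + Fintype.card ι * (ENNReal.ofReal (5 ^ γ) *
      ∫⁻ θ : AddCircle (2 : ℝ), ENNReal.ofReal ((chord θ)⁻¹ ^ γ)) with hL
  have hLt : L < ⊤ := ENNReal.add_lt_top.2 ⟨by simp, ENNReal.mul_lt_top (by simp)
    (ENNReal.mul_lt_top ENNReal.ofReal_lt_top (lintegral_chord_rpow_lt_top h0 h1))⟩
  have hρ := measurable_timeWeight c
  refine lt_of_le_of_lt (lintegral_prod_le_of_classes (fun i => A i = β)
    (h := fun i x => timeWeight c (x i).1 *
      if A i = β then ENNReal.ofReal (scaleProd A x i ^ γ) else 1) (K := C * (L * L))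
      ?_ ?_ ?_ ?_) (ENNReal.pow_lt_top (ENNReal.mul_lt_top hC (ENNReal.mul_lt_top hLt hLt)))
  · intro i
    have := measurable_scaleProd A i
    split_ifs <;> fun_prop
  · intro i hi x y hxy h
    simp only [hi, if_true]
    rw [hxy, scaleProd_congr A i hxy fun q hq => h q (by rw [hi] at hq; exact hq)]
  · intro i hi x y hxy
    simp only [hi, if_false, hxy]
  · intro i x
    have hle : ∀ y : Cylinder, (timeWeight c (Function.update x i y i).1 *
        if A i = β then ENNReal.ofReal (scaleProd A (Function.update x i y) i ^ γ) else 1) ≤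
        timeWeight c y.1 *
        (scaleBound γ (Finset.univ.filter fun q => A q ≠ A i) (fun q => cylAdd (x q)) (cylAdd y) *
        scaleBound γ (Finset.univ.filter fun q => A q ≠ A i) (fun q => cylSub (x q))
          (cylSub y)) := by
      intro y
      rw [Function.update_self]
      gcongr
      split_ifs
      · exact ofReal_scaleProd_rpow_le h0 h1 A x i y
      -- Points of the other class carry only the time weight; bounding 1 by the scale factors gives
      -- the same constant for every point.
      · exact one_le_mul_of_one_le_of_one_le le_self_add le_self_add
    refine (lintegral_mono hle).trans ((hcyl _ _ (measurable_scaleBound _ _ _)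
      (measurable_scaleBound _ _ _)).trans ?_)
    gcongr <;> exact lintegral_scaleBound_le γ _ _

/-- The integrable function dominating the correlator after rotation to real time. -/
def dominating (γ c : ℝ) (A : ι → Bool) (x : ι → Cylinder) : ENNReal :=
  (∏ i, (timeWeight c (x i).1 * if A i = true then ENNReal.ofReal (scaleProd A x i ^ γ) else 1)) +
  ∏ i, (timeWeight c (x i).1 * if A i = false then ENNReal.ofReal (scaleProd A x i ^ γ) else 1)

theorem measurable_dominating (γ c : ℝ) (A : ι → Bool) : Measurable (dominating γ c A) := by
  have hρ := measurable_timeWeight c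
  have h : ∀ β : Bool, Measurable fun x : ι → Cylinder => ∏ i, (timeWeight c (x i).1 *
      if A i = β then ENNReal.ofReal (scaleProd A x i ^ γ) else 1) := by
    intro β
    refine Finset.measurable_fun_prod _ fun i _ => ?_
    have := measurable_scaleProd A i
    split_ifs <;> fun_prop
  exact (h true).add (h false)

theorem lintegral_dominating_lt_top {γ c : ℝ} (h0 : 0 < γ) (h1 : γ < 1) (hc : 0 < c)
    (A : ι → Bool) : ∫⁻ x, dominating γ c A x < ⊤ := by
  have hρ := measurable_timeWeight c
  have h : Measurable fun x : ι → Cylinder => ∏ i, (timeWeight c (x i).1 *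
      if A i = true then ENNReal.ofReal (scaleProd A x i ^ γ) else 1) := by
    refine Finset.measurable_fun_prod _ fun i _ => ?_
    have := measurable_scaleProd A i
    split_ifs <;> fun_prop
  unfold dominating
  rw [lintegral_add_left h]
  exact ENNReal.add_lt_top.2 ⟨lintegral_weighted_scaleProd_lt_top h0 h1 hc A true,
    lintegral_weighted_scaleProd_lt_top h0 h1 hc A false⟩

/-- The scales of the two classes depend on each other's points, so the full product cannot be
integrated point by point. Splitting it as XY ≤ X² + Y² breaks this cycle; squaring doubles the
exponents, hence the requirement 2a² ≤ γ. -/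
theorem ofReal_prod_scaleProd_le {γ c : ℝ} (A : ι → Bool) (a : ι → ℝ)
    (ha : ∀ i, 2 * a i ^ 2 ≤ γ) (x : ι → Cylinder) :
    ENNReal.ofReal ((∏ i, Real.exp (-(c * |(x i).1|))) * ∏ i, scaleProd A x i ^ (a i ^ 2)) ≤
      dominating γ c A x := by
  set X : Bool → ℝ := fun β => ∏ i, if A i = β then scaleProd A x i ^ (γ / 2) else 1
  have hs : ∀ i, 0 ≤ scaleProd A x i := fun i => zero_le_one.trans (one_le_scaleProd A x i)
  have h1 : ∏ i, scaleProd A x i ^ (a i ^ 2) ≤ X true * X false := by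
    rw [← Finset.prod_mul_distrib]
    refine Finset.prod_le_prod (fun i _ => Real.rpow_nonneg (hs i) _) fun i _ => ?_
    have : scaleProd A x i ^ (a i ^ 2) ≤ scaleProd A x i ^ (γ / 2) :=
      Real.rpow_le_rpow_of_exponent_le (one_le_scaleProd A x i) (by linarith [ha i])
    cases A i <;> simpa using this
  have h2 : X true * X false ≤ X true ^ 2 + X false ^ 2 := by
    nlinarith [sq_nonneg (X true - X false), sq_nonneg (X true), sq_nonneg (X false)]
  have h3 : ∀ β, X β ^ 2 = ∏ i, if A i = β then scaleProd A x i ^ γ else 1 := by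
    intro β
    rw [← Finset.prod_pow]
    refine Finset.prod_congr rfl fun i _ => ?_
    split_ifs
    · rw [← Real.rpow_natCast, ← Real.rpow_mul (hs i)]
      congr 1; push_cast; ring
    · simp
  have h4 : ∀ β, ENNReal.ofReal ((∏ i, Real.exp (-(c * |(x i).1|))) * X β ^ 2) =
      ∏ i, (timeWeight c (x i).1 *
        if A i = β then ENNReal.ofReal (scaleProd A x i ^ γ) else 1) := by
    intro β
    rw [h3, ← Finset.prod_mul_distrib, ENNReal.ofReal_prod_of_nonneg]
    · refine Finset.prod_congr rfl fun i _ => ?_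
      rw [ENNReal.ofReal_mul (Real.exp_pos _).le, timeWeight]
      split_ifs <;> simp
    · intro i _
      refine mul_nonneg (Real.exp_pos _).le ?_
      split_ifs
      · exact Real.rpow_nonneg (hs i) _
      · exact zero_le_one
  have h5 : 0 ≤ ∏ i, Real.exp (-(c * |(x i).1|)) := Finset.prod_nonneg fun i _ => (Real.exp_pos _).le
  refine (ENNReal.ofReal_le_ofReal (mul_le_mul_of_nonneg_left (h1.trans h2) h5)).trans ?_
  rw [mul_add, ENNReal.ofReal_add (mul_nonneg h5 (sq_nonneg _)) (mul_nonneg h5 (sq_nonneg _)), h4,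
    h4, dominating]

end Dominating

/-! ### Pointwise domination -/

section Pointwise

variable {ι : Type*}

/-- The class of negative charges. -/
def negClass (a : ι → ℝ) (i : ι) : Bool := decide (a i < 0)

theorem negClass_ne_of_mul_neg {a : ι → ℝ} {p q : ι} (h : a p * a q < 0) :
    negClass a q ≠ negClass a p := by
  unfold negClass
  rcases mul_neg_iff.1 h with ⟨h1, h2⟩ | ⟨h1, h2⟩
  · simp [h2, h1.not_gt]
  · simp [h1, h2.not_gt]

/-- The electrostatic inequality at scale 1/`invScale`: an opposite charge contributes 5/chord to
`invScale`, so by `hrot` the scale is below the chiral distance to it. Nonzero chords are needed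
because the inverse of 0 is 0, and such a summand would impose no constraint. -/
theorem sum_log_coneRatio_le [Fintype ι] (a : ι → ℝ) (P : ι → ℂ × AddCircle (2 : ℝ))
    (κ' : ℂ × AddCircle (2 : ℝ) → AddCircle (2 : ℝ)) (κ : Cylinder → AddCircle (2 : ℝ))
    (hrot : ∀ p q, chord (κ (rotate p) - κ (rotate q)) ≤ 5 * ‖1 - coneRatio κ' p q‖)
    (hne : ∀ p q, p ≠ q → 1 - coneRatio κ' (P p) (P q) ≠ 0)
    (hne' : ∀ p q, negClass a p ≠ negClass a q → κ (rotate (P p)) - κ (rotate (P q)) ≠ 0) :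
    ∑ p, ∑ q, a p * a q * Real.log ‖1 - coneRatio κ' (P p) (P q)‖ ≤
      (∑ p, ∑ q, |a p * a q| * Real.log 3) +
        ∑ p, a p ^ 2 * Real.log (invScale κ (negClass a) (fun p => rotate (P p)) p) := by
  set S := invScale κ (negClass a) (fun p => rotate (P p)) with hS
  have hS1 : ∀ p, 1 ≤ S p := one_le_invScale _ _ _
  have hSpos : ∀ p, 0 < S p := fun p => zero_lt_one.trans_le (hS1 p)
  have hε : ∀ p q, a p * a q < 0 → (S p)⁻¹ ≤ ‖1 - coneRatio κ' (P p) (P q)‖ := by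
    intro p q hpq
    have hA := negClass_ne_of_mul_neg hpq
    have h1 : 5 * (chord (κ (rotate (P p)) - κ (rotate (P q))))⁻¹ ≤ S p :=
      le_invScale κ (negClass a) (fun p => rotate (P p)) hA
    have h2 : 0 < chord (κ (rotate (P p)) - κ (rotate (P q))) :=
      lt_of_le_of_ne (chord_nonneg _) fun h => hne' p q hA.symm (chord_eq_zero.1 h.symm)
    have h3 := hrot (P p) (P q)
    have h4 : (S p)⁻¹ ≤ (5 * (chord (κ (rotate (P p)) - κ (rotate (P q))))⁻¹)⁻¹ :=
      inv_anti₀ (by positivity) h1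
    rw [mul_inv, inv_inv] at h4
    linarith
  have := sum_log_chiral_le a (fun p => Real.pi * (P p).1.re) (fun p => (S p)⁻¹)
    (fun p => circleChar (κ' (P p))) (fun p => norm_circleChar _) (fun p => inv_pos.2 (hSpos p))
    (fun p => inv_le_one_of_one_le₀ (hS1 p))
    (fun p q hpq => ⟨hε p q hpq, by
      have h := hε q p (by rwa [mul_comm])
      rw [norm_one_sub_coneRatio_comm] at h
      exact h⟩) hne
  simp only [Real.log_inv, mul_neg, Finset.sum_neg_distrib, sub_neg_eq_add] at this
  exact this

theorem prod_scaleProd_rpow_eq [Fintype ι] (a : ι → ℝ) (x : ι → Cylinder) :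
    ∏ i, scaleProd (negClass a) x i ^ (a i ^ 2) = Real.exp
      ((∑ p, a p ^ 2 * Real.log (invScale cylAdd (negClass a) x p)) +
        ∑ p, a p ^ 2 * Real.log (invScale cylSub (negClass a) x p)) := by
  rw [← Finset.sum_add_distrib, Real.exp_sum]
  refine Finset.prod_congr rfl fun i _ => ?_
  have h1 := zero_lt_one.trans_le (one_le_invScale cylAdd (negClass a) x i)
  have h2 := zero_lt_one.trans_le (one_le_invScale cylSub (negClass a) x i)
  rw [scaleProd, Real.rpow_def_of_pos (mul_pos h1 h2), Real.log_mul h1.ne' h2.ne']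
  congr 1
  ring

end Pointwise

theorem abs_contour_im_le {m : ℕ} {t : Fin (m + 1) → ℝ} {R : ℝ} (ht : ∀ j, |t j| ≤ R) (s : ℝ) :
    |(contour t s).im| ≤ (1 + 2 * m) * R := by
  rw [contour_im]
  have h : ∀ j : Fin m, |max 0 (min 1 (s - (j : ℕ))) * (t j.succ - t j.castSucc)| ≤ 2 * R := by
    intro j
    have h1 : |max 0 (min 1 (s - (j : ℕ)))| ≤ 1 := by
      rw [abs_of_nonneg (le_max_left _ _)]
      exact max_le zero_le_one (min_le_left _ _)
    have h2 : |t j.succ - t j.castSucc| ≤ 2 * R :=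
      (abs_sub _ _).trans (by linarith [ht j.succ, ht j.castSucc])
    rw [abs_mul]
    calc _ ≤ 1 * (2 * R) := mul_le_mul h1 h2 (abs_nonneg _) zero_le_one
      _ = _ := one_mul _
  calc _ ≤ |t 0| + ∑ j : Fin m, |max 0 (min 1 (s - (j : ℕ))) * (t j.succ - t j.castSucc)| :=
        (abs_add_le _ _).trans (by gcongr; exact Finset.abs_sum_le_sum_abs _ _)
    _ ≤ R + ∑ j : Fin m, 2 * R := by gcongr with j; exacts [ht 0, h j]
    _ = _ := by simp; ring

/-- No two insertions are at zero chiral distance, before or after the rotation to real time. -/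
def NonDegenerate {m w : ℕ} (u : Fin (m + 1) → Cylinder)
    (z : Fin w → ℝ × AddCircle (2 : ℝ)) : Prop :=
  ∀ p q : Fin (m + 1) ⊕ Fin w, p ≠ q →
    (1 - coneRatio coneAdd (insertions u z p) (insertions u z q) ≠ 0 ∧
      1 - coneRatio coneSub (insertions u z p) (insertions u z q) ≠ 0) ∧
    (cylAdd (rotate (insertions u z p)) - cylAdd (rotate (insertions u z q)) ≠ 0 ∧
      cylSub (rotate (insertions u z p)) - cylSub (rotate (insertions u z q)) ≠ 0)

/-- The two logarithmic sums give the scale factors and twice the log 3 constant. Neutrality gives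
decay in Re τ; since |Im τ| ≤ (1 + 2m)R, decay in rotated time costs only the remaining constant. -/
theorem norm_freeFactor_mul_norm_screeningIntegrand_le {m w : ℕ} {b : ℝ} {n : Fin (m + 1) → ℤ}
    (hw : (w : ℤ) = -∑ j, n j) {R : ℝ} {u : Fin (m + 1) → Cylinder} (hu : ∀ j, |(u j).1| ≤ R)
    {z : Fin w → ℝ × AddCircle (2 : ℝ)} (hz : NonDegenerate u z) :
    ‖freeFactor (charge b n) u‖ * ‖screeningIntegrand b w (charge b n) u z‖ ≤
      Real.exp (2 * (∑ p, ∑ q, |allCharges b n w p * allCharges b n w q| * Real.log 3) +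
        (m + 1 + w) * (2 * Real.pi * b ^ 2 * ((1 + 2 * m) * R))) *
      ((∏ p, Real.exp (-((2 * Real.pi * b ^ 2) * |(rotate (insertions u z p)).1|))) *
        ∏ p, scaleProd (negClass (allCharges b n w)) (fun p => rotate (insertions u z p)) p ^
          (allCharges b n w p ^ 2)) *
      ∏ l, ‖deriv (contour (fun j => (u j).1)) (z l).1‖ := by
  rw [norm_freeFactor_mul_norm_screeningIntegrand]
  refine mul_le_mul_of_nonneg_right ?_ (Finset.prod_nonneg fun l _ => norm_nonneg _)
  set a := allCharges b n w
  set P := insertions u z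
  have hadd := sum_log_coneRatio_le a P coneAdd cylAdd chord_cylAdd_le
    (fun p q h => (hz p q h).1.1) (fun p q h => (hz p q fun e => h (by rw [e])).2.1)
  have hsub := sum_log_coneRatio_le a P coneSub cylSub chord_cylSub_le
    (fun p q h => (hz p q h).1.2) (fun p q h => (hz p q fun e => h (by rw [e])).2.2)
  have hre : ∀ p, (P p).1.re = Sum.elim (fun _ => (0 : ℝ)) (fun l => (tubePoint u (z l)).1.re) p := by
    rintro (j | l)
    · simp [P, insertions, external_re]
    · simp [P, insertions]
  have hconf := sum_charges_mul_abs_sub_le b n hw (fun l => (tubePoint u (z l)).1.re)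
  have hsum : ∑ p, ∑ q, a p * a q * pairEnergy (P p) (P q) =
      Real.pi * (∑ p, ∑ q, a p * a q * |(P p).1.re - (P q).1.re|) +
      (∑ p, ∑ q, a p * a q * Real.log ‖1 - coneRatio coneAdd (P p) (P q)‖) +
      ∑ p, ∑ q, a p * a q * Real.log ‖1 - coneRatio coneSub (P p) (P q)‖ := by
    simp only [pairEnergy, mul_add, Finset.sum_add_distrib, Finset.mul_sum]
    congr 2
    refine Finset.sum_congr rfl fun p _ => Finset.sum_congr rfl fun q _ => ?_
    ring
  rw [prod_scaleProd_rpow_eq, ← Real.exp_sum, ← Real.exp_add, ← Real.exp_add, hsum]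
  apply Real.exp_le_exp.2
  have hc0 : 0 ≤ 2 * Real.pi * b ^ 2 := by positivity
  have hR : 0 ≤ (1 + 2 * m) * R := (abs_nonneg _).trans (abs_contour_im_le hu 0)
  have htime : ∑ p, (2 * Real.pi * b ^ 2) * |(rotate (P p)).1| ≤
      (2 * Real.pi * b ^ 2) * (∑ l, |(tubePoint u (z l)).1.re|) +
        (m + 1 + w) * (2 * Real.pi * b ^ 2 * ((1 + 2 * m) * R)) := by
    have he : ∀ j : Fin (m + 1), |(rotate (P (Sum.inl j))).1| ≤ (1 + 2 * m) * R := by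
      intro j
      have h1 : rotate (P (Sum.inl j)) = u j := rotate_external u j
      have h2 := (abs_nonneg _).trans (hu j)
      have h3 : 0 ≤ 2 * (m : ℝ) * R := by positivity
      rw [h1]
      linarith [hu j]
    have hs : ∀ l : Fin w, |(rotate (P (Sum.inr l))).1| ≤
        |(tubePoint u (z l)).1.re| + (1 + 2 * m) * R := by
      intro l
      exact (abs_add_le _ _).trans (add_le_add le_rfl (abs_contour_im_le hu _))
    rw [Fintype.sum_sum_type]
    calc _ ≤ (∑ j : Fin (m + 1), (2 * Real.pi * b ^ 2) * ((1 + 2 * m) * R)) +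
          ∑ l : Fin w, (2 * Real.pi * b ^ 2) * (|(tubePoint u (z l)).1.re| + (1 + 2 * m) * R) := by
          gcongr with j _ l _
          · exact he j
          · exact hs l
      _ = _ := by
          simp only [mul_add, Finset.sum_add_distrib, Finset.sum_const, Finset.card_univ,
            Fintype.card_fin, nsmul_eq_mul, Finset.mul_sum]
          push_cast
          ring
  simp only [hre] at hconf ⊢
  rw [Finset.sum_neg_distrib]
  have hpi := mul_le_mul_of_nonneg_left hconf Real.pi_pos.le
  linarith

/-! ### Almost every configuration is non-degenerate -/

theorem ae_circle_ne (c : AddCircle (2 : ℝ)) : ∀ᵐ y : AddCircle (2 : ℝ), y ≠ c := by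
  rw [ae_iff]
  have h : {y : AddCircle (2 : ℝ) | ¬ y ≠ c} ⊆ Metric.closedBall c 0 := by
    intro y hy
    simpa using hy
  refine measure_mono_null h ?_
  rw [AddCircle.volume_closedBall]
  simp

theorem ae_cone_ne {f : ℝ → ℝ} (hf : Measurable f) (c : AddCircle (2 : ℝ)) :
    (∀ᵐ x : Cylinder, (f x.1 : AddCircle (2 : ℝ)) + x.2 ≠ c) ∧
      ∀ᵐ x : Cylinder, (f x.1 : AddCircle (2 : ℝ)) - x.2 ≠ c := by
  have hmk : Measurable fun t : ℝ => (t : AddCircle (2 : ℝ)) := AddCircle.measurable_mk'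
  constructor
  · have hs : MeasurableSet {x : Cylinder | (f x.1 : AddCircle (2 : ℝ)) + x.2 ≠ c} :=
      (measurableSet_eq_fun (by fun_prop) measurable_const).compl
    rw [Measure.volume_eq_prod, Measure.ae_prod_iff_ae_ae hs]
    refine Filter.Eventually.of_forall fun t => ?_
    filter_upwards [ae_circle_ne (c - (f t : AddCircle (2 : ℝ)))] with y hy h
    exact hy (by rw [← h]; abel)
  · have hs : MeasurableSet {x : Cylinder | (f x.1 : AddCircle (2 : ℝ)) - x.2 ≠ c} :=
      (measurableSet_eq_fun (by fun_prop) measurable_const).compl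
    rw [Measure.volume_eq_prod, Measure.ae_prod_iff_ae_ae hs]
    refine Filter.Eventually.of_forall fun t => ?_
    filter_upwards [ae_circle_ne ((f t : AddCircle (2 : ℝ)) - c)] with y hy h
    exact hy (by rw [← h]; abel)

section Generic

variable {ι : Type*} [Fintype ι] {G : Cylinder → AddCircle (2 : ℝ)}

theorem ae_pi_ne_const (hG : Measurable G) (h : ∀ c, ∀ᵐ x, G x ≠ c) (i : ι)
    (c : AddCircle (2 : ℝ)) : ∀ᵐ x : ι → Cylinder, G (x i) ≠ c := by
  classical
  refine ae_pi_of_forall_update i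
    (measurableSet_eq_fun (by fun_prop) measurable_const).compl fun x => ?_
  simpa using h c

theorem ae_pi_ne (hG : Measurable G) (h : ∀ c, ∀ᵐ x, G x ≠ c) {i j : ι} (hij : i ≠ j) :
    ∀ᵐ x : ι → Cylinder, G (x i) ≠ G (x j) := by
  classical
  refine ae_pi_of_forall_update i
    (measurableSet_eq_fun (by fun_prop) (by fun_prop)).compl fun x => ?_
  simpa [Function.update_of_ne hij.symm] using h (G (x j))

end Generic

theorem ae_nonLightCone (m : ℕ) : ∀ᵐ u : Fin (m + 1) → Cylinder, NonLightCone u := by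
  unfold NonLightCone
  rw [ae_all_iff]; intro j
  rw [ae_all_iff]; intro j'
  by_cases hj : j < j'
  · filter_upwards [ae_pi_ne measurable_cylAdd (fun c => (ae_cone_ne measurable_id c).1) hj.ne,
      ae_pi_ne measurable_cylSub (fun c => (ae_cone_ne measurable_id c).2) hj.ne] with u h1 h2 _
    constructor
    · intro h
      apply h1
      rw [← sub_eq_zero, ← h, cylAdd, cylAdd, AddCircle.coe_sub]; abel
    · intro h
      apply h2
      rw [← sub_eq_zero, ← h, cylSub, cylSub, AddCircle.coe_sub]; abel
  · exact Filter.Eventually.of_forall fun u h => absurd h hj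

theorem coneRatio_ne_one {κ : ℂ × AddCircle (2 : ℝ) → AddCircle (2 : ℝ)}
    {p q : ℂ × AddCircle (2 : ℝ)} (h : κ p ≠ κ q) : 1 - coneRatio κ p q ≠ 0 := by
  intro h0
  have h1 : coneRatio κ p q = 1 := (sub_eq_zero.1 h0).symm
  have h2 := norm_chiralRatio (Real.pi * p.1.re) (Real.pi * q.1.re) (norm_circleChar (κ p))
    (norm_circleChar (κ q))
  rw [coneRatio] at h1
  rw [h1, norm_one] at h2
  rw [chiralRatio, ← h2, Complex.ofReal_one, one_mul, ← circleChar_sub, ← circleChar_zero] at h1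
  exact h (sub_eq_zero.1 (circleChar_injective h1))

/-- For a fixed contour parameter each coincidence fixes the space coordinate of a screening point,
a null condition. Coincidences among external points alone are excluded by `NonLightCone`. -/
theorem ae_nonDegenerate {m : ℕ} (w : ℕ) {u : Fin (m + 1) → Cylinder} (hu : NonLightCone u) :
    ∀ᵐ z : Fin w → ℝ × AddCircle (2 : ℝ), NonDegenerate u z := by
  have hc := continuous_contour fun j => (u j).1
  have hmk : Measurable fun t : ℝ => (t : AddCircle (2 : ℝ)) := AddCircle.measurable_mk'
  have him : Measurable fun s => (contour (fun j => (u j).1) s).im := by fun_prop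
  have hre : Measurable fun s => (contour (fun j => (u j).1) s).re +
    (contour (fun j => (u j).1) s).im := by fun_prop
  have key : ∀ (G : Cylinder → AddCircle (2 : ℝ)) (K : ℂ × AddCircle (2 : ℝ) → AddCircle (2 : ℝ)),
      Measurable G → (∀ c, ∀ᵐ x, G x ≠ c) → (∀ x, K (tubePoint u x) = G x) →
      (∀ j j', j ≠ j' → K (external u j) ≠ K (external u j')) →
      ∀ᵐ z : Fin w → ℝ × AddCircle (2 : ℝ), ∀ p q : Fin (m + 1) ⊕ Fin w, p ≠ q →
        K (insertions u z p) ≠ K (insertions u z q) := by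
    intro G K hG h hK hext
    rw [ae_all_iff]; intro p
    rw [ae_all_iff]; intro q
    rcases p with j | l <;> rcases q with j' | l'
    · exact Filter.Eventually.of_forall fun z hpq => hext j j' fun h => hpq (by rw [h])
    · filter_upwards [ae_pi_ne_const hG h l' (K (external u j))] with z hz _
      simpa [insertions, hK] using hz.symm
    · filter_upwards [ae_pi_ne_const hG h l (K (external u j'))] with z hz _
      simpa [insertions, hK] using hz
    · by_cases hl : l = l'
      · exact Filter.Eventually.of_forall fun z hpq => absurd (by rw [hl]) hpq
      · filter_upwards [ae_pi_ne hG h hl] with z hz _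
        simpa [insertions, hK] using hz
  have hadd : ∀ j j', j ≠ j' → cylAdd (u j) ≠ cylAdd (u j') := by
    have h : ∀ j j', j < j' → cylAdd (u j) ≠ cylAdd (u j') := by
      intro j j' hj h0
      apply (hu j j' hj).1
      rw [← sub_eq_zero.2 h0, cylAdd, cylAdd, AddCircle.coe_sub]; abel
    intro j j' hj
    rcases lt_or_gt_of_ne hj with hj | hj
    exacts [h _ _ hj, (h _ _ hj).symm]
  have hsub : ∀ j j', j ≠ j' → cylSub (u j) ≠ cylSub (u j') := by
    have h : ∀ j j', j < j' → cylSub (u j) ≠ cylSub (u j') := by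
      intro j j' hj h0
      apply (hu j j' hj).2
      rw [← sub_eq_zero.2 h0, cylSub, cylSub, AddCircle.coe_sub]; abel
    intro j j' hj
    rcases lt_or_gt_of_ne hj with hj | hj
    exacts [h _ _ hj, (h _ _ hj).symm]
  have hextAdd : ∀ j, coneAdd (external u j) = cylAdd (u j) := fun j => by
    simp only [coneAdd, external_im]; rfl
  have hextSub : ∀ j, coneSub (external u j) = cylSub (u j) := fun j => by
    simp only [coneSub, external_im]; rfl
  filter_upwards [
    key _ coneAdd (by fun_prop) (fun c => (ae_cone_ne him c).1) (fun x => rfl)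
      (by simpa only [hextAdd] using hadd),
    key _ coneSub (by fun_prop) (fun c => (ae_cone_ne him c).2) (fun x => rfl)
      (by simpa only [hextSub] using hsub),
    key _ (fun p => cylAdd (rotate p)) (by fun_prop) (fun c => (ae_cone_ne hre c).1) (fun x => rfl)
      (by simpa only [rotate_external] using hadd),
    key _ (fun p => cylSub (rotate p)) (by fun_prop) (fun c => (ae_cone_ne hre c).2) (fun x => rfl)
      (by simpa only [rotate_external] using hsub)] with z h1 h2 h3 h4 p q hpq
  exact ⟨⟨coneRatio_ne_one (h1 p q hpq), coneRatio_ne_one (h2 p q hpq)⟩,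
    sub_ne_zero.2 (h3 p q hpq), sub_ne_zero.2 (h4 p q hpq)⟩

/-! ### Measurability -/

theorem measurable_green : Measurable green := by
  have := continuous_circleChar.measurable
  unfold green
  fun_prop

theorem measurable_timeOrdered {α : Type*} [MeasurableSpace α] {s s' : α → ℝ}
    {p p' : α → ℂ × AddCircle (2 : ℝ)} (hs : Measurable s) (hs' : Measurable s')
    (hp : Measurable p) (hp' : Measurable p') :
    Measurable fun a => timeOrdered (s a) (s' a) (p a) (p' a) :=
  Measurable.ite (measurableSet_le hs' hs) (hp.sub hp') (hp'.sub hp)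

theorem measurable_external {m : ℕ} (j : Fin (m + 1)) :
    Measurable fun u : Fin (m + 1) → Cylinder => external u j := by
  unfold external
  fun_prop

theorem measurable_freeFactor {m : ℕ} (α : Fin (m + 1) → ℂ) : Measurable (freeFactor α) := by
  have h : ∀ j j' : Fin (m + 1), Measurable fun u : Fin (m + 1) → Cylinder =>
      green (timeOrdered (j : ℕ) (j' : ℕ) (external u j) (external u j')) := fun j j' =>
    measurable_green.comp (measurable_timeOrdered measurable_const measurable_const
      (measurable_external j) (measurable_external j'))
  unfold freeFactor
  fun_prop

theorem measurable_screeningIntegrand {m : ℕ} (b : ℝ) (w : ℕ) (α : Fin (m + 1) → ℂ) :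
    Measurable fun q : (Fin (m + 1) → Cylinder) × (Fin w → ℝ × AddCircle (2 : ℝ)) =>
      screeningIntegrand b w α q.1 q.2 := by
  have hpair : ∀ l : Fin w, Measurable
      fun q : (Fin (m + 1) → Cylinder) × (Fin w → ℝ × AddCircle (2 : ℝ)) =>
        ((fun j => (q.1 j).1 : Fin (m + 1) → ℝ), (q.2 l).1) := fun l => by fun_prop
  have htube : ∀ l : Fin w, Measurable
      fun q : (Fin (m + 1) → Cylinder) × (Fin w → ℝ × AddCircle (2 : ℝ)) =>
        tubePoint q.1 (q.2 l) := fun l =>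
    Measurable.prodMk (continuous_contour_uncurry.measurable.comp (hpair l)) (by fun_prop)
  have hd : ∀ l : Fin w, Measurable
      fun q : (Fin (m + 1) → Cylinder) × (Fin w → ℝ × AddCircle (2 : ℝ)) =>
        deriv (contour (fun j => (q.1 j).1)) (q.2 l).1 := fun l =>
    (measurable_deriv_with_param continuous_contour_uncurry).comp (hpair l)
  have h1 : ∀ (j : Fin (m + 1)) (l : Fin w), Measurable
      fun q : (Fin (m + 1) → Cylinder) × (Fin w → ℝ × AddCircle (2 : ℝ)) =>
        green (timeOrdered (j : ℕ) (q.2 l).1 (external q.1 j) (tubePoint q.1 (q.2 l))) :=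
    fun j l => measurable_green.comp (measurable_timeOrdered measurable_const (by fun_prop)
      ((measurable_external j).comp measurable_fst) (htube l))
  have h2 : ∀ l l' : Fin w, Measurable
      fun q : (Fin (m + 1) → Cylinder) × (Fin w → ℝ × AddCircle (2 : ℝ)) =>
        green (timeOrdered (q.2 l).1 (q.2 l').1 (tubePoint q.1 (q.2 l)) (tubePoint q.1 (q.2 l'))) :=
    fun l l' => measurable_green.comp (measurable_timeOrdered (by fun_prop) (by fun_prop)
      (htube l) (htube l'))
  unfold screeningIntegrand
  refine Measurable.mul (Complex.measurable_exp.comp (Measurable.sub (Measurable.const_mul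
    (Finset.measurable_fun_sum _ fun j _ => Finset.measurable_fun_sum _ fun l _ =>
      (h1 j l).const_mul _) _) (Measurable.const_mul
    (Finset.measurable_fun_sum _ fun l _ => Finset.measurable_fun_sum _ fun l' _ => h2 l l') _)))
    (Finset.measurable_fun_prod _ fun l _ => hd l)

theorem measurable_screeningIntegrand_apply {m : ℕ} (b : ℝ) (w : ℕ) (α : Fin (m + 1) → ℂ)
    (u : Fin (m + 1) → Cylinder) : Measurable fun z => screeningIntegrand b w α u z := by
  have h1 := measurable_screeningIntegrand b w α
  have h2 : Measurable fun z : Fin w → ℝ × AddCircle (2 : ℝ) => (u, z) := measurable_prodMk_left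
  have h3 := h1.comp h2
  simp only [Function.comp_def] at h3
  exact h3

theorem IsTestFunction.continuous {f : Cylinder → ℂ} (hf : IsTestFunction f) : Continuous f := by
  have hq : IsOpenQuotientMap
      (Prod.map (id : ℝ → ℝ) (fun x : ℝ => (x : AddCircle (2 : ℝ)))) :=
    IsOpenQuotientMap.id.prodMap QuotientAddGroup.isOpenQuotientMap_mk
  exact hq.isQuotientMap.continuous_iff.2 hf.smooth.continuous

theorem IsTestFunction.exists_bound {f : Cylinder → ℂ} (hf : IsTestFunction f) :
    ∃ M R : ℝ, (∀ x, ‖f x‖ ≤ M) ∧ ∀ x, f x ≠ 0 → |x.1| ≤ R := by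
  obtain ⟨M, hM⟩ := hf.compact.exists_bound_of_continuous hf.continuous
  obtain ⟨R, hR⟩ := hf.compact.isCompact.exists_bound_of_continuousOn
    (f := fun x : Cylinder => x.1) continuous_fst.continuousOn
  exact ⟨M, R, hM, fun x hx => hR x (subset_tsupport f hx)⟩

/-! ### Absolute convergence -/

theorem exists_charge_exponent {ι : Type*} [Fintype ι] (a : ι → ℝ) (ha : ∀ i, 2 * a i ^ 2 < 1) :
    ∃ γ : ℝ, 0 < γ ∧ γ < 1 ∧ ∀ i, 2 * a i ^ 2 ≤ γ := by
  have h : ∀ s : Finset ι, ∃ γ : ℝ, 0 < γ ∧ γ < 1 ∧ ∀ i ∈ s, 2 * a i ^ 2 ≤ γ := by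
    classical
    intro s
    induction s using Finset.induction_on with
    -- The starting value only keeps γ strictly positive when all charges vanish.
    | empty => exact ⟨1 / 2, by norm_num, by norm_num, by simp⟩
    | insert i s hi ih =>
      obtain ⟨γ, h0, h1, h⟩ := ih
      refine ⟨max γ (2 * a i ^ 2), lt_max_of_lt_left h0, max_lt h1 (ha i), ?_⟩
      intro j hj
      rcases Finset.mem_insert.1 hj with rfl | hj
      · exact le_max_right _ _
      · exact (h j hj).trans (le_max_left _ _)
  obtain ⟨γ, h0, h1, h⟩ := h Finset.univ
  exact ⟨γ, h0, h1, fun i => h i (Finset.mem_univ i)⟩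

theorem two_mul_allCharges_sq_lt {b : ℝ} (hb0 : 0 < b) (hb : b < 1 / Real.sqrt 2) {m : ℕ}
    {n : Fin (m + 1) → ℤ} (hn : ∀ j, |(n j : ℝ)| < 1 / (Real.sqrt 2 * b)) (w : ℕ)
    (p : Fin (m + 1) ⊕ Fin w) : 2 * allCharges b n w p ^ 2 < 1 := by
  have h2 : 0 < Real.sqrt 2 := by positivity
  have hs : Real.sqrt 2 ^ 2 = 2 := Real.sq_sqrt (by norm_num)
  have key : ∀ x : ℝ, |x| < 1 / Real.sqrt 2 → 2 * x ^ 2 < 1 := by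
    intro x hx
    rw [lt_div_iff₀ h2] at hx
    have := pow_lt_pow_left₀ hx (by positivity) two_ne_zero
    rw [mul_pow, hs, sq_abs] at this
    linarith
  rcases p with j | l
  · apply key
    have h3 := mul_lt_mul_of_pos_left (hn j) hb0
    simp only [allCharges, Sum.elim_inl]
    rw [abs_mul, abs_of_pos hb0]
    refine h3.trans_eq ?_
    field_simp
  · apply key
    simpa [allCharges, abs_of_pos hb0] using hb

/-- The central estimate: the pointwise bound is pushed forward to rotated screening points, and
external and screening points together form one configuration over which `dominating` is integrable.
Bounded external times keep the constant `K` uniform. -/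
theorem lintegral_correlator_lt_top {b : ℝ} (hb0 : 0 < b) (hb : b < 1 / Real.sqrt 2) {m : ℕ}
    {n : Fin (m + 1) → ℤ} (hn : ∀ j, |(n j : ℝ)| < 1 / (Real.sqrt 2 * b)) {w : ℕ}
    (hw : (w : ℤ) = -∑ j, n j) (R : ℝ) :
    ∫⁻ u in {u : Fin (m + 1) → Cylinder | ∀ j, |(u j).1| ≤ R},
      ‖freeFactor (charge b n) u‖ₑ * ∫⁻ z, ‖screeningIntegrand b w (charge b n) u z‖ₑ < ⊤ := by
  set a := allCharges b n w with ha
  obtain ⟨γ, hγ0, hγ1, hγ⟩ := exists_charge_exponent a (two_mul_allCharges_sq_lt hb0 hb hn w)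
  set c := 2 * Real.pi * b ^ 2 with hc
  have hc0 : 0 < c := by positivity
  set K := Real.exp (2 * (∑ p, ∑ q, |a p * a q| * Real.log 3) +
        (m + 1 + w) * (c * ((1 + 2 * m) * R))) with hK
  have hS : MeasurableSet {u : Fin (m + 1) → Cylinder | ∀ j, |(u j).1| ≤ R} := by
    rw [Set.ofPred_forall]
    exact MeasurableSet.iInter fun j => measurableSet_le (by fun_prop) measurable_const
  set D : (Fin (m + 1) → Cylinder) × (Fin w → Cylinder) → ENNReal := fun q =>
    dominating γ c (negClass a) ((MeasurableEquiv.sumPiEquivProdPi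
      (fun _ : Fin (m + 1) ⊕ Fin w => Cylinder)).symm q) with hD
  have hDm : Measurable D := (measurable_dominating γ c _).comp (MeasurableEquiv.measurable _)
  have hDint : ∫⁻ u, ∫⁻ v, D (u, v) < ⊤ := by
    rw [← lintegral_prod _ hDm.aemeasurable]
    have hpres := volume_measurePreserving_sumPiEquivProdPi_symm
      (fun _ : Fin (m + 1) ⊕ Fin w => Cylinder)
    have := hpres.lintegral_comp_emb (MeasurableEquiv.measurableEmbedding _)
      (dominating γ c (negClass a))
    rw [← Measure.volume_eq_prod]
    exact this.trans_lt (lintegral_dominating_lt_top hγ0 hγ1 hc0 _)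
  have hpt : ∀ᵐ u : Fin (m + 1) → Cylinder, (∀ j, |(u j).1| ≤ R) →
      ‖freeFactor (charge b n) u‖ₑ * ∫⁻ z, ‖screeningIntegrand b w (charge b n) u z‖ₑ ≤
        ENNReal.ofReal K * ((m + 2) ^ w * ∫⁻ v, D (u, v)) := by
    filter_upwards [ae_nonLightCone m] with u hu hR
    have hSI := measurable_screeningIntegrand_apply b w (charge b n) u
    have hDu : Measurable fun v => D (u, v) := hDm.comp (measurable_prodMk_left (x := u))
    rw [← lintegral_const_mul _ hSI.enorm]
    have hle : ∀ᵐ z : Fin w → ℝ × AddCircle (2 : ℝ),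
        ‖freeFactor (charge b n) u‖ₑ * ‖screeningIntegrand b w (charge b n) u z‖ₑ ≤
        ENNReal.ofReal K * ((∏ l, ‖deriv (contour (fun j => (u j).1)) (z l).1‖ₑ) *
          D (u, fun l => rotate (tubePoint u (z l)))) := by
      filter_upwards [ae_nonDegenerate w hu] with z hz
      have h1 := ENNReal.ofReal_le_ofReal
        (norm_freeFactor_mul_norm_screeningIntegrand_le (b := b) hw hR hz)
      rw [ENNReal.ofReal_mul (norm_nonneg _), ofReal_norm, ofReal_norm] at h1
      refine h1.trans ?_
      have hx : (fun p => rotate (insertions u z p)) = (MeasurableEquiv.sumPiEquivProdPi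
          (fun _ : Fin (m + 1) ⊕ Fin w => Cylinder)).symm
            (u, fun l => rotate (tubePoint u (z l))) := by
        funext p
        rcases p with j | l
        · exact rotate_external u j
        · rfl
      have h2 := ofReal_prod_scaleProd_le (c := c) (negClass a) a hγ
        (fun p => rotate (insertions u z p))
      have hKpos : 0 ≤ K := (Real.exp_pos _).le
      have hsp : 0 ≤ ∏ p, scaleProd (negClass a) (fun p => rotate (insertions u z p)) p ^ (a p ^ 2) :=
        Finset.prod_nonneg fun p _ => Real.rpow_nonneg
          (zero_le_one.trans (one_le_scaleProd _ _ _)) _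
      rw [ENNReal.ofReal_mul (mul_nonneg hKpos (mul_nonneg
        (Finset.prod_nonneg fun p _ => (Real.exp_pos _).le) hsp)), ENNReal.ofReal_mul hKpos,
        ENNReal.ofReal_prod_of_nonneg fun l _ => norm_nonneg _, mul_assoc]
      simp only [ofReal_norm]
      rw [mul_comm (∏ l, ‖deriv (contour (fun j => (u j).1)) (z l).1‖ₑ)]
      gcongr
      refine h2.trans (le_of_eq ?_)
      simp only [hD, ← hx]
    refine (lintegral_mono_ae hle).trans ?_
    rw [lintegral_const_mul' _ _ ENNReal.ofReal_ne_top]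
    gcongr
    exact lintegral_tube_le u hDu
  refine lt_of_le_of_lt (setLIntegral_mono_ae' hS hpt) ?_
  refine (setLIntegral_le_lintegral _ _).trans_lt ?_
  rw [lintegral_const_mul' _ _ ENNReal.ofReal_ne_top,
    lintegral_const_mul' _ _ (by finiteness)]
  exact ENNReal.mul_lt_top ENNReal.ofReal_lt_top
    (ENNReal.mul_lt_top (by finiteness) hDint)

theorem ae_integrable_screeningIntegrand {b : ℝ} (hb0 : 0 < b) (hb : b < 1 / Real.sqrt 2) {m : ℕ}
    {n : Fin (m + 1) → ℤ} (hn : ∀ j, |(n j : ℝ)| < 1 / (Real.sqrt 2 * b)) {w : ℕ}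
    (hw : (w : ℤ) = -∑ j, n j) :
    ∀ᵐ u : Fin (m + 1) → Cylinder, Integrable (screeningIntegrand b w (charge b n) u) := by
  have hSI := measurable_screeningIntegrand b w (charge b n)
  have hmeas : Measurable fun u : Fin (m + 1) → Cylinder =>
      ‖freeFactor (charge b n) u‖ₑ * ∫⁻ z, ‖screeningIntegrand b w (charge b n) u z‖ₑ :=
    (measurable_freeFactor _).enorm.mul hSI.enorm.lintegral_prod_right'
  have hS : ∀ R : ℝ, MeasurableSet {u : Fin (m + 1) → Cylinder | ∀ j, |(u j).1| ≤ R} := by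
    intro R
    rw [Set.ofPred_forall]
    exact MeasurableSet.iInter fun j => measurableSet_le (by fun_prop) measurable_const
  -- Finiteness on each time slab gives it almost everywhere; integer slabs exhaust the
  -- configuration space. The free factor is an exponential, hence nonzero, and can then be divided
  -- out.
  have hall : ∀ᵐ u : Fin (m + 1) → Cylinder, ∀ R : ℕ, (∀ j, |(u j).1| ≤ (R : ℝ)) →
      ‖freeFactor (charge b n) u‖ₑ * ∫⁻ z, ‖screeningIntegrand b w (charge b n) u z‖ₑ < ⊤ := by
    rw [ae_all_iff]
    intro R
    exact (ae_restrict_iff' (hS R)).1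
      (ae_lt_top hmeas (lintegral_correlator_lt_top hb0 hb hn hw R).ne)
  filter_upwards [hall] with u hu
  obtain ⟨R, hR⟩ := exists_nat_ge (∑ j, |(u j).1|)
  have hlt := hu R fun j => (Finset.single_le_sum (f := fun j => |(u j).1|)
    (fun j _ => abs_nonneg _) (Finset.mem_univ j)).trans hR
  refine ⟨(measurable_screeningIntegrand_apply b w _ u).aestronglyMeasurable, ?_⟩
  have hne : ‖freeFactor (charge b n) u‖ₑ ≠ 0 := by
    rw [enorm_ne_zero]; exact Complex.exp_ne_zero _
  exact ENNReal.lt_top_of_mul_ne_top_right hlt.ne hne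

theorem integrable_smeared_integerCorrelator {b : ℝ} (μ : ℝ) (hb0 : 0 < b)
    (hb : b < 1 / Real.sqrt 2) {m : ℕ} {n : Fin (m + 1) → ℤ}
    (hn : ∀ j, |(n j : ℝ)| < 1 / (Real.sqrt 2 * b)) {f : Fin (m + 1) → Cylinder → ℂ}
    (hf : ∀ j, IsTestFunction (f j)) :
    Integrable fun u : Fin (m + 1) → Cylinder => (∏ j, f j (u j)) * integerCorrelator b μ n u := by
  by_cases h0 : 0 ≤ -∑ j, n j
  swap
  · simp only [integerCorrelator, if_neg h0, mul_zero]
    exact integrable_zero _ _ _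
  have hw : ((-∑ j, n j).toNat : ℤ) = -∑ j, n j := Int.toNat_of_nonneg h0
  simp only [integerCorrelator, h0, if_true]
  set w := (-∑ j, n j).toNat
  have hSI := measurable_screeningIntegrand b w (charge b n)
  have hff := measurable_freeFactor (charge b n)
  have hcorr : Measurable (lorentzCorrelator b μ w (charge b n)) := by
    have : Measurable fun u => ∫ z, screeningIntegrand b w (charge b n) u z :=
      (hSI.stronglyMeasurable.integral_prod_right').measurable
    unfold lorentzCorrelator
    fun_prop
  have hfm : ∀ j, Measurable (f j) := fun j => (hf j).continuous.measurable
  choose M R hM hR using fun j => (hf j).exists_bound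
  set R' := ∑ j, |R j|
  set B : ENNReal := ENNReal.ofReal (∏ j, M j) * ‖(-(μ : ℂ)) ^ w / (w.factorial : ℂ)‖ₑ
  have hS : MeasurableSet {u : Fin (m + 1) → Cylinder | ∀ j, |(u j).1| ≤ R'} := by
    rw [Set.ofPred_forall]
    exact MeasurableSet.iInter fun j => measurableSet_le (by fun_prop) measurable_const
  refine ⟨((Finset.measurable_fun_prod _ fun j _ => by fun_prop).mul hcorr).aestronglyMeasurable, ?_⟩
  -- Compact supports confine all external times to a slab and bounded test functions contribute a
  -- constant, so the central estimate applies.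
  have hpt : ∀ u : Fin (m + 1) → Cylinder,
      ‖(∏ j, f j (u j)) * lorentzCorrelator b μ w (charge b n) u‖ₑ ≤
        Set.indicator {u : Fin (m + 1) → Cylinder | ∀ j, |(u j).1| ≤ R'}
          (fun u => B * (‖freeFactor (charge b n) u‖ₑ *
            ∫⁻ z, ‖screeningIntegrand b w (charge b n) u z‖ₑ)) u := by
    intro u
    by_cases hu : ∀ j, |(u j).1| ≤ R'
    · rw [Set.indicator_of_mem (Set.mem_ofPred.2 hu), enorm_mul]
      simp only [B, lorentzCorrelator, enorm_mul, mul_assoc]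
      gcongr
      · rw [← ofReal_norm, norm_prod]
        exact ENNReal.ofReal_le_ofReal
          (Finset.prod_le_prod (fun j _ => norm_nonneg _) fun j _ => hM j _)
      · exact enorm_integral_le_lintegral_enorm _
    · rw [Set.indicator_of_notMem (by simpa using hu)]
      push Not at hu
      obtain ⟨j, hj⟩ := hu
      have hz : f j (u j) = 0 := by
        by_contra hne
        refine absurd (hR j _ hne) (not_le.2 (lt_of_le_of_lt ?_ hj))
        exact (le_abs_self _).trans (Finset.single_le_sum (f := fun j => |R j|)
          (fun j _ => abs_nonneg _) (Finset.mem_univ j))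
      rw [Finset.prod_eq_zero (Finset.mem_univ j) hz]
      simp
  refine (lintegral_mono hpt).trans_lt ?_
  have hBt : B ≠ ⊤ := ENNReal.mul_ne_top ENNReal.ofReal_ne_top enorm_ne_top
  rw [lintegral_indicator hS, lintegral_const_mul' _ _ hBt]
  exact ENNReal.mul_lt_top hBt.lt_top (lintegral_correlator_lt_top hb0 hb hn hw R')

end TimelikeLiouville

end

/-- The number of insertions is `k = m + 1 ≥ 1`. The first part says that the contour integral
defining the point correlator converges absolutely at almost every configuration, so that its value
is meaningful. The second part is absolute convergence of the smeared integral, for every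
assignment `C` of values to the correlator on the light-cone exceptional set; the finite value of
the integral does not depend on the assignment. -/
theorem theorem2p4 (b μ : ℝ) (hb0 : 0 < b) (hb : b < 1 / Real.sqrt 2) (hμ : 0 < μ)
    (m : ℕ) (n : Fin (m + 1) → ℤ)
    (hn : ∀ j, |(n j : ℝ)| < 1 / (Real.sqrt 2 * b)) :
    (∀ w : ℕ, (w : ℤ) = -∑ j, n j →
      ∀ᵐ u : Fin (m + 1) → TimelikeLiouville.Cylinder,
        MeasureTheory.Integrable
          (TimelikeLiouville.screeningIntegrand b w (TimelikeLiouville.charge b n) u)) ∧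
    (∀ f : Fin (m + 1) → TimelikeLiouville.Cylinder → ℂ,
      (∀ j, TimelikeLiouville.IsTestFunction (f j)) →
      ∀ C : (Fin (m + 1) → TimelikeLiouville.Cylinder) → ℂ,
        (∀ u, TimelikeLiouville.NonLightCone u →
          C u = TimelikeLiouville.integerCorrelator b μ n u) →
        MeasureTheory.Integrable
          (fun u : Fin (m + 1) → TimelikeLiouville.Cylinder => (∏ j, f j (u j)) * C u) ∧
        ∫ u : Fin (m + 1) → TimelikeLiouville.Cylinder, (∏ j, f j (u j)) * C u =
          TimelikeLiouville.smearedExpectation b μ n f) := by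
  refine ⟨fun w hw => TimelikeLiouville.ae_integrable_screeningIntegrand hb0 hb hn hw,
    fun f hf C hC => ?_⟩
  -- The light-cone set is null, so reassigning values there affects neither integrability nor the
  -- integral.
  have hae : (fun u : Fin (m + 1) → TimelikeLiouville.Cylinder => (∏ j, f j (u j)) * C u)
      =ᵐ[volume] fun u => (∏ j, f j (u j)) * TimelikeLiouville.integerCorrelator b μ n u := by
    filter_upwards [TimelikeLiouville.ae_nonLightCone m] with u hu
    rw [hC u hu]
  exact ⟨(TimelikeLiouville.integrable_smeared_integerCorrelator μ hb0 hb hn hf).congr hae.symm,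
    integral_congr_ae hae⟩
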